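/- Let $d\ge 0$ be an integer and $\mathbb T^d=\mathbb R^d/\mathbb Z^d$ the flat torus. Let $G:\mathbb R\to(-\infty,+\infty]$ be convex and lower semicontinuous with $G(0)=0$, and let $G^*(p)=\sup_{s\in\mathbb R}(ps-G(s))$. Let $c>0$, and let $J,J_*:\mathbb R\to\mathbb R$ be functions satisfying $$G(s)+G^*(p)\ \ge\ sp+c\,|J(s)-J_*(p)|^2\qquad\text{for all } s,p\in\mathbb R.\tag{QP}$$ Let $\Psi\in C^{1,1}(\mathbb T^d)$ (i.e. $\Psi$ is $C^1$ with Lipschitz gradient), let $T>0$, and let $\overline{m_0}$ be a probability measure on $\mathbb T^d$. Let $\mathcal H$ be the set of pairs $(m,v)$ where $m\in L^1((0,T)\times\mathbb T^d)$, $m\ge 0$ a.e., $\int_{\mathbb T^d}m(t,x)\,dx=1$ for a.e. $t$, $v:(0,T)\times\mathbb T^d\to\mathbb R^d$ is measurable, $mv\in L^1$, and $\partial_t m+\nabla\cdot(mv)=0$, $m_0=\overline{m_0}$ in the sense that $$\int_0^T\!\!\int_{\mathbb T^d}\big(m\,\partial_t\phi+mv\cdot\nabla\phi\big)\,dx\,dt+\int_{\mathbb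 T^d}\phi(0,x)\,d\overline{m_0}(x)=0\qquad\text{for all }\phi\in C^1_c([0,T)\times\mathbb T^d).$$ For $(m,v)\in\mathcal H$ set $$\mathcal B(m,v)=\int_0^T\!\!\int_{\mathbb T^d}\Big(\tfrac12 m|v|^2+G(m)\Big)\,dx\,dt+\int_{\mathbb T^d}\Psi\,dm_T\ \in(-\infty,+\infty],$$ where $m_T$ is the value at $t=T$ of the weakly continuous curve $[0,T]\to\mathcal P(\mathbb T^d)$ that coincides with $m(t,\cdot)\,dx$ for a.e. $t$. Let $(m,v)\in\mathcal H$ be a minimizer of $\mathcal B$ over $\mathcal H$ with $\mathcal B(m,v)<+\infty$. Then: 1. for every $t_1>0$ there is a constant $C$, depending only on $t_1$, $\Psi$, $G$ and the constant $c$ of (QP) (and not on $T$, $\overline{m_0}$, $J$, $J_*$, $(m,v)$ or $\delta$), such that for every $\delta\in\mathbb R^d$ $$\|J(m(\cdot,\cdot+\delta))-J(m)\|_{L^2([t_1,T]\times\mathbb T^d)}\le C|\delta| ;$$ 2. $J(m)\in L^2_{\mathrm{loc}}((0,T];H^1(\mathbb T^d))$, i.e. for a.e. $t\in(0,T)$ the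 function $J(m(t,\cdot))$ has a weak gradient, and both $J(m)$ and $\nabla (J(m))$ are in $L^2([t_1,T]\times\mathbb T^d)$ for every $t_1>0$. -/

import Mathlib

open MeasureTheory Set
open scoped ContDiff

noncomputable section

namespace MFG

/-- The Euclidean space `ℝ^d`. -/
abbrev E (d : ℕ) : Type := EuclideanSpace ℝ (Fin d)

/-- The flat torus `ℝ^d / ℤ^d`; its `volume` is the Lebesgue (Haar) measure of total mass one. -/
abbrev Torus (d : ℕ) : Type := UnitAddTorus (Fin d)

/-- The projection `ℝ^d → ℝ^d / ℤ^d`. -/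
def proj {d : ℕ} (x : E d) : Torus d := fun i => ((x i : ℝ) : UnitAddCircle)

/-- The gradient of a function on the torus (computed in the chart `h ↦ x + proj h` at `x`). -/
def torusGrad {d : ℕ} (f : Torus d → ℝ) (x : Torus d) : E d :=
  gradient (fun h : E d => f (x + proj h)) 0

/-- `Ψ` is of class `C^{1,1}` on the torus: its periodic lift is `C^1` with Lipschitz gradient. -/
def IsC11 {d : ℕ} (Ψ : Torus d → ℝ) : Prop :=
  ContDiff ℝ 1 (fun x : E d => Ψ (proj x)) ∧
    ∃ K : NNReal, LipschitzWith K (gradient (fun x : E d => Ψ (proj x)))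

/-- `φ(t,x)` is of class `C^1` on `ℝ × 𝕋^d`. -/
def IsC1SpaceTime {d : ℕ} (φ : ℝ × Torus d → ℝ) : Prop :=
  ContDiff ℝ 1 (fun q : ℝ × E d => φ (q.1, proj q.2))

/-- Lebesgue measure on the cylinder `(0,T) × 𝕋^d`. -/
def cyl (d : ℕ) (T : ℝ) : Measure (ℝ × Torus d) :=
  (volume.restrict (Ioo 0 T)).prod volume

/-- Lebesgue measure on `[t₁,T] × 𝕋^d`. -/
def cylFrom (d : ℕ) (t₁ T : ℝ) : Measure (ℝ × Torus d) :=
  (volume.restrict (Icc t₁ T)).prod volume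

/-- The congestion penalization: a proper, convex (convex epigraph), lower semicontinuous function
`G : ℝ → (-∞,+∞]` with `G(0) = 0`. -/
structure IsPenalization (G : ℝ → EReal) : Prop where
  ne_bot : ∀ s, G s ≠ ⊥
  zero : G 0 = 0
  convex : Convex ℝ {q : ℝ × ℝ | G q.1 ≤ (q.2 : EReal)}
  lsc : LowerSemicontinuous G

/-- The convex conjugate `G*(p) = sup_s (p s - G(s))`. -/
def conj (G : ℝ → EReal) (p : ℝ) : EReal :=
  ⨆ s : ℝ, (((p * s : ℝ) : EReal) - G s)

/-- The inequality `G(s) + G*(p) ≥ s p + c |J(s) - J_*(p)|²` for all real `s, p`. -/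
def QP (G : ℝ → EReal) (c : ℝ) (J Js : ℝ → ℝ) : Prop :=
  ∀ s p : ℝ, ((s * p + c * |J s - Js p| ^ 2 : ℝ) : EReal) ≤ G s + conj G p

/-- The admissible set: densities `m ∈ L¹` with `m ≥ 0` and unit mass at a.e. time, and measurable
fields `v` with `m v ∈ L¹`, solving `∂ₜ m + ∇·(m v) = 0`, `m(0) = m₀` in the sense of distributions
(test functions in `C^1_c([0,T) × 𝕋^d)`). -/
structure Admissible {d : ℕ} (T : ℝ) (m₀ : Measure (Torus d))
    (m : ℝ × Torus d → ℝ) (v : ℝ × Torus d → E d) : Prop where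
  integrable : Integrable m (cyl d T)
  measurable_field : AEStronglyMeasurable v (cyl d T)
  nonneg : ∀ᵐ q ∂(cyl d T), 0 ≤ m q
  mass : ∀ᵐ t ∂(volume.restrict (Ioo 0 T)), ∫ x, m (t, x) = 1
  integrable_flux : Integrable (fun q => m q • v q) (cyl d T)
  continuity : ∀ φ : ℝ × Torus d → ℝ, IsC1SpaceTime φ →
    (∃ τ < T, ∀ t, τ ≤ t → ∀ x, φ (t, x) = 0) →
    (∫ q, (m q * deriv (fun s => φ (s, q.2)) q.1
        + inner ℝ (m q • v q) (torusGrad (fun x => φ (q.1, x)) q.2)) ∂(cyl d T))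
      + ∫ x, φ (0, x) ∂m₀ = 0

/-- `μ` is a continuous representative of `m`: a curve `[0,T] → 𝒫(𝕋^d)`, continuous for weak
convergence of measures (the topology of the distance `W₂`), with `μ_t = m(t,·) dx` for
a.e. `t`. -/
def IsContinuousRepresentative {d : ℕ} (T : ℝ) (m : ℝ × Torus d → ℝ)
    (μ : ℝ → ProbabilityMeasure (Torus d)) : Prop :=
  ContinuousOn μ (Icc 0 T) ∧
    ∀ᵐ t ∂(volume.restrict (Ioo 0 T)),
      (μ t : Measure (Torus d)) = volume.withDensity (fun x => ENNReal.ofReal (m (t, x)))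

open Classical in
/-- The final measure `m_T`: the value at `T` of the (unique) continuous representative of `m`. -/
def finalMeasure {d : ℕ} (T : ℝ) (m : ℝ × Torus d → ℝ) : Measure (Torus d) :=
  if h : ∃ μ : ℝ → ProbabilityMeasure (Torus d), IsContinuousRepresentative T m μ then
    (h.choose T : Measure (Torus d))
  else 0

/-- The kinetic energy `∫∫ ½ m |v|²`, with values in `[0,+∞]`. -/
def kinetic {d : ℕ} (T : ℝ) (m : ℝ × Torus d → ℝ) (v : ℝ × Torus d → E d) : ENNReal :=
  ∫⁻ q, ENNReal.ofReal (m q * ‖v q‖ ^ 2 / 2) ∂(cyl d T)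

/-- The congestion energy `∫∫ G(m)`, positive part minus negative part. A convex `G` has an affine
minorant, so the negative part is finite for `m ∈ L¹` and the value lies in `(-∞,+∞]`. -/
def congestion {d : ℕ} (T : ℝ) (G : ℝ → EReal) (m : ℝ × Torus d → ℝ) : EReal :=
  ((∫⁻ q, (G (m q)).toENNReal ∂(cyl d T) : ENNReal) : EReal)
    - ((∫⁻ q, (-(G (m q))).toENNReal ∂(cyl d T) : ENNReal) : EReal)

/-- The functional `ℬ(m,v) = ∫∫ (½ m |v|² + G(m)) dx dt + ∫ Ψ dm_T`. -/
def energy {d : ℕ} (T : ℝ) (G : ℝ → EReal) (Ψ : Torus d → ℝ)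
    (m : ℝ × Torus d → ℝ) (v : ℝ × Torus d → E d) : EReal :=
  ((kinetic T m v : ENNReal) : EReal) + congestion T G m
    + ((∫ x, Ψ x ∂(finalMeasure T m) : ℝ) : EReal)

/-- `(m,v)` solves `min ℬ` over the admissible set; the minimum is finite. -/
structure IsMinimizer {d : ℕ} (T : ℝ) (G : ℝ → EReal) (Ψ : Torus d → ℝ) (m₀ : Measure (Torus d))
    (m : ℝ × Torus d → ℝ) (v : ℝ × Torus d → E d) : Prop where
  admissible : Admissible T m₀ m v
  finite : energy T G Ψ m v < ⊤
  le : ∀ (m' : ℝ × Torus d → ℝ) (v' : ℝ × Torus d → E d), Admissible T m₀ m' v' →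
    energy T G Ψ m v ≤ energy T G Ψ m' v'

/-- `w` is the weak gradient of `f` on the torus. -/
def IsWeakGradient {d : ℕ} (f : Torus d → ℝ) (w : Torus d → E d) : Prop :=
  ∀ φ : Torus d → ℝ, ContDiff ℝ ∞ (fun x : E d => φ (proj x)) →
    ∫ x, f x • torusGrad φ x = - ∫ x, φ x • w x

/-- `f ∈ L²_loc((0,T]; H¹(𝕋^d))`: for a.e. `t` the slice `f(t,·)` has a weak gradient `w(t,·)`, and
`f` and `w` are in `L²([t₁,T] × 𝕋^d)` for every `t₁ > 0`. -/
def MemL2locH1 {d : ℕ} (T : ℝ) (f : ℝ × Torus d → ℝ) : Prop :=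
  ∃ w : ℝ × Torus d → E d,
    (∀ t₁ : ℝ, 0 < t₁ → MemLp f 2 (cylFrom d t₁ T) ∧ MemLp w 2 (cylFrom d t₁ T)) ∧
    ∀ᵐ t ∂(volume.restrict (Ioo 0 T)),
      IsWeakGradient (fun x => f (t, x)) (fun x => w (t, x))

end MFG

end

/-! The estimate comes from comparing the minimizer with translates of itself. Take a cutoff `ζ`
with `ζ(0) = 0` and `ζ = 1` on `[t₁,∞)`. The pair with density `m(t, x + ζ(t)δ)` and velocity `v(t,
x + ζ(t)δ) - ζ'(t)δ` is admissible, with the same initial datum. Write `E₊`, `E₋` for the energies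
of the translates along `δ` and `-δ`, and `E` for the minimum. Translation leaves the congestion
term unchanged. The kinetic terms of `±δ` add up, by the parallelogram law and unit mass, to twice
the original one plus `|δ|² ∫ ζ'²`. The final costs add up to at most twice the original one plus
`L|δ|²`, since `Ψ` is `C^{1,1}`. Hence `E₊ + E₋ ≤ 2E + (D + L)|δ|²`, and `E ≤ E₋` gives `E₊ - E ≤ (D
+ L)|δ|²`.

Strict gain comes from `QP`: with a subgradient of `G` at the midpoint as dual variable, `G` is
midpoint convex with defect at least `(c/4)|J(s) - J(s')|²` (`IsPenalization.midpoint_le`).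
Averaging densities and fluxes of `(m,v)` and its `δ`-translate gives an admissible pair, and
`m|v|²` is jointly convex in density and flux. Therefore `E ≤ (E + E₊)/2 - (c/4) ∫∫ |J(m₊) -
J(m)|²`, and the square of the `L²` norm is at most `2(D + L)/c · |δ|²`
(`IsMinimizer.integral_sq_le`). On `[t₁,T]` the shift is exactly `δ`.

Two technical points support this. The value at `T` needs a weakly continuous representative, built
from Fourier moments (`exists_isContinuousRepresentative`). Also, `J` is not assumed measurable, but
the midpoint inequality forces continuity inside the domain of `G`.

The `H¹` statement follows by weak compactness: bounded difference quotients have a weak limit in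
`L²`, which is a weak gradient on almost every time slice (`exists_weak_gradient`). -/

namespace MFG

variable {d : ℕ}

/-! ### Calculus on the torus through the covering by `ℝ^d` -/

theorem isOpenQuotientMap_proj : IsOpenQuotientMap (proj : E d → Torus d) := by
  have h : (proj : E d → Torus d) =
      (Pi.map fun _ => (QuotientAddGroup.mk : ℝ → UnitAddCircle)) ∘
        (EuclideanSpace.equiv (Fin d) ℝ).toHomeomorph := rfl
  rw [h]
  exact (IsOpenQuotientMap.piMap fun _ => QuotientAddGroup.isOpenQuotientMap_mk).comp
    (Homeomorph.isOpenQuotientMap _)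

theorem continuous_proj : Continuous (proj : E d → Torus d) := isOpenQuotientMap_proj.continuous

theorem proj_surjective : Function.Surjective (proj : E d → Torus d) :=
  isOpenQuotientMap_proj.surjective

theorem proj_add (x y : E d) : proj (x + y) = proj x + proj y := by
  ext i; simp [proj]

theorem proj_neg (x : E d) : proj (-x) = -proj x := by
  ext i; simp [proj]

theorem proj_sub (x y : E d) : proj (x - y) = proj x - proj y := by
  ext i; simp [proj]

theorem proj_zero : proj (0 : E d) = 0 := by
  ext i; simp [proj]

theorem torusGrad_proj (f : Torus d → ℝ) (y : E d) :
    torusGrad f (proj y) = gradient (fun x => f (proj x)) y := by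
  unfold torusGrad gradient
  simp_rw [← proj_add]
  rw [fderiv_comp_add_left (f := fun x => f (proj x)), add_zero]

theorem inner_gradient_left {F : E d → ℝ} (y w : E d) :
    inner ℝ (gradient F y) w = fderiv ℝ F y w := by
  unfold gradient
  rw [InnerProductSpace.toDual_symm_apply]

theorem continuous_of_comp_proj {X Y : Type*} [TopologicalSpace X] [TopologicalSpace Y]
    {f : X × Torus d → Y} (hf : Continuous fun q : X × E d => f (q.1, proj q.2)) :
    Continuous f :=
  (IsOpenQuotientMap.id.prodMap isOpenQuotientMap_proj).continuous_comp_iff.1 hf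

theorem continuous_of_comp_proj' {Y : Type*} [TopologicalSpace Y]
    {f : Torus d → Y} (hf : Continuous fun x : E d => f (proj x)) : Continuous f :=
  isOpenQuotientMap_proj.continuous_comp_iff.1 hf

theorem continuous_gradient {F : E d → ℝ} (hF : ContDiff ℝ 1 F) : Continuous (gradient F) := by
  unfold gradient
  exact (InnerProductSpace.toDual ℝ (E d)).symm.continuous.comp (hF.continuous_fderiv one_ne_zero)

theorem continuous_torusGrad {f : Torus d → ℝ} (hf : ContDiff ℝ 1 fun x : E d => f (proj x)) :
    Continuous (torusGrad f) := by
  apply continuous_of_comp_proj'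
  simp_rw [torusGrad_proj]
  exact continuous_gradient hf

section SpaceTime

variable {φ : ℝ × Torus d → ℝ}

theorem IsC1SpaceTime.continuous (hφ : IsC1SpaceTime φ) : Continuous φ :=
  continuous_of_comp_proj (ContDiff.continuous hφ)

theorem IsC1SpaceTime.hasFDerivAt (hφ : IsC1SpaceTime φ) (t : ℝ) (y : E d) :
    HasFDerivAt (fun q : ℝ × E d => φ (q.1, proj q.2))
      (fderiv ℝ (fun q : ℝ × E d => φ (q.1, proj q.2)) (t, y)) (t, y) :=
  (ContDiff.differentiable hφ one_ne_zero (t, y)).hasFDerivAt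

theorem IsC1SpaceTime.deriv_time (hφ : IsC1SpaceTime φ) (t : ℝ) (y : E d) :
    deriv (fun s => φ (s, proj y)) t =
      fderiv ℝ (fun q : ℝ × E d => φ (q.1, proj q.2)) (t, y) (1, 0) := by
  have h := (hφ.hasFDerivAt t y).comp_hasDerivAt t
    ((hasDerivAt_id t).prodMk (hasDerivAt_const t y))
  exact h.deriv

theorem IsC1SpaceTime.inner_torusGrad (hφ : IsC1SpaceTime φ) (t : ℝ) (y w : E d) :
    inner ℝ (torusGrad (fun x => φ (t, x)) (proj y)) w =
      fderiv ℝ (fun q : ℝ × E d => φ (q.1, proj q.2)) (t, y) (0, w) := by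
  have h : HasFDerivAt (fun y : E d => φ (t, proj y)) _ y := (hφ.hasFDerivAt t y).comp y
    ((hasFDerivAt_const t y).prodMk (hasFDerivAt_id y))
  rw [torusGrad_proj, inner_gradient_left, h.fderiv]
  simp

theorem IsC1SpaceTime.torusGrad_eq (hφ : IsC1SpaceTime φ) (t : ℝ) (y : E d) :
    torusGrad (fun x => φ (t, x)) (proj y) = (InnerProductSpace.toDual ℝ (E d)).symm
      ((fderiv ℝ (fun q : ℝ × E d => φ (q.1, proj q.2)) (t, y)).comp
        (ContinuousLinearMap.inr ℝ ℝ (E d))) := by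
  refine ext_inner_right ℝ fun w => ?_
  rw [hφ.inner_torusGrad, InnerProductSpace.toDual_symm_apply]
  simp

theorem IsC1SpaceTime.continuous_deriv (hφ : IsC1SpaceTime φ) :
    Continuous fun q : ℝ × Torus d => deriv (fun s => φ (s, q.2)) q.1 := by
  apply continuous_of_comp_proj
  simp_rw [hφ.deriv_time]
  exact (ContDiff.continuous_fderiv hφ one_ne_zero).clm_apply continuous_const

theorem IsC1SpaceTime.continuous_torusGrad (hφ : IsC1SpaceTime φ) :
    Continuous fun q : ℝ × Torus d => torusGrad (fun x => φ (q.1, x)) q.2 := by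
  apply continuous_of_comp_proj
  simp_rw [hφ.torusGrad_eq]
  refine (InnerProductSpace.toDual ℝ (E d)).symm.continuous.comp ?_
  exact (ContDiff.continuous_fderiv hφ one_ne_zero).clm_comp continuous_const

end SpaceTime

theorem exists_bound_of_continuous {F : Type*} [NormedAddCommGroup F] {g : ℝ × Torus d → F}
    (hg : Continuous g) (T : ℝ) : ∃ C, ∀ᵐ q ∂(cyl d T), ‖g q‖ ≤ C := by
  obtain ⟨C, hC⟩ := ((isCompact_Icc (a := (0 : ℝ)) (b := T)).prod
    (isCompact_univ (X := Torus d))).exists_bound_of_continuousOn hg.continuousOn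
  refine ⟨C, ?_⟩
  have : ∀ᵐ q ∂(cyl d T), q.1 ∈ Ioo 0 T := by
    unfold cyl
    exact Measure.quasiMeasurePreserving_fst.ae (ae_restrict_mem measurableSet_Ioo)
  filter_upwards [this] with q hq
  exact hC q ⟨Ioo_subset_Icc_self hq, mem_univ _⟩

theorem Admissible.integrable_test {T : ℝ} {m₀ : Measure (Torus d)} {m : ℝ × Torus d → ℝ}
    {v : ℝ × Torus d → E d} (h : Admissible T m₀ m v) {φ : ℝ × Torus d → ℝ}
    (hφ : IsC1SpaceTime φ) :
    Integrable (fun q => m q * deriv (fun s => φ (s, q.2)) q.1) (cyl d T) ∧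
    Integrable (fun q => inner ℝ (m q • v q) (torusGrad (fun x => φ (q.1, x)) q.2))
      (cyl d T) := by
  obtain ⟨C, hC⟩ := exists_bound_of_continuous hφ.continuous_deriv T
  obtain ⟨C', hC'⟩ := exists_bound_of_continuous hφ.continuous_torusGrad T
  refine ⟨h.integrable.mul_bdd hφ.continuous_deriv.aestronglyMeasurable hC, ?_⟩
  refine (h.integrable_flux.norm.mul_const C').mono
    (h.integrable_flux.aestronglyMeasurable.inner hφ.continuous_torusGrad.aestronglyMeasurable) ?_
  filter_upwards [hC'] with q hq
  refine (norm_inner_le_norm _ _).trans ?_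
  rw [Real.norm_of_nonneg (mul_nonneg (norm_nonneg _) ((norm_nonneg _).trans hq))]
  gcongr

theorem isC1SpaceTime_mul {η : ℝ → ℝ} (hη : ContDiff ℝ 1 η) {f : Torus d → ℝ}
    (hf : ContDiff ℝ 1 fun x : E d => f (proj x)) :
    IsC1SpaceTime fun q : ℝ × Torus d => η q.1 * f q.2 :=
  (hη.comp contDiff_fst).mul (hf.comp contDiff_snd)

theorem torusGrad_const_mul (a : ℝ) {f : Torus d → ℝ}
    (hf : ContDiff ℝ 1 fun x : E d => f (proj x)) (x : Torus d) :
    torusGrad (fun x => a * f x) x = a • torusGrad f x := by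
  obtain ⟨y, rfl⟩ := proj_surjective x
  refine ext_inner_right ℝ fun w => ?_
  rw [torusGrad_proj, torusGrad_proj, inner_smul_left, inner_gradient_left, inner_gradient_left,
    fderiv_const_mul (hf.differentiable one_ne_zero y)]
  simp

/-! ### Convex analysis of `G` and consequences of `QP` -/

namespace IsPenalization

variable {G : ℝ → EReal} (hG : IsPenalization G)
include hG

theorem convexOn_toReal : ConvexOn ℝ {s | G s ≠ ⊤} fun s => (G s).toReal := by
  have key : ∀ x ∈ {s | G s ≠ ⊤}, ∀ y ∈ {s | G s ≠ ⊤}, ∀ a b : ℝ, 0 ≤ a → 0 ≤ b → a + b = 1 →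
      G (a • x + b • y) ≤ ((a • (G x).toReal + b • (G y).toReal : ℝ) : EReal) := by
    intro x hx y hy a b ha hb hab
    have h1 : (x, (G x).toReal) ∈ {q : ℝ × ℝ | G q.1 ≤ (q.2 : EReal)} :=
      (EReal.coe_toReal hx (hG.ne_bot x)).ge
    have h2 : (y, (G y).toReal) ∈ {q : ℝ × ℝ | G q.1 ≤ (q.2 : EReal)} :=
      (EReal.coe_toReal hy (hG.ne_bot y)).ge
    exact hG.convex h1 h2 ha hb hab
  refine ⟨fun x hx y hy a b ha hb hab => ?_, fun x hx y hy a b ha hb hab => ?_⟩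
  · exact ((key x hx y hy a b ha hb hab).trans_lt (EReal.coe_lt_top _)).ne
  · exact EReal.toReal_le_toReal (key x hx y hy a b ha hb hab) (hG.ne_bot _) (EReal.coe_ne_top _)

/-- The right derivative serves as slope: by convexity it dominates the slopes of chords to the left
and is dominated by those to the right. -/
theorem exists_subgradient {x : ℝ} (hx : x ∈ interior {s | G s ≠ ⊤}) :
    ∃ p : ℝ, ∀ y, (((G x).toReal + p * (y - x) : ℝ) : EReal) ≤ G y := by
  have hc := hG.convexOn_toReal
  refine ⟨derivWithin (fun s => (G s).toReal) (Ioi x) x, fun y => ?_⟩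
  by_cases hy : G y = ⊤
  · simp [hy]
  rw [← EReal.coe_toReal hy (hG.ne_bot y), EReal.coe_le_coe_iff]
  rcases lt_trichotomy x y with h | h | h
  · have := hc.rightDeriv_le_slope_of_mem_interior hx hy h
    rw [slope_def_field, le_div_iff₀ (sub_pos.2 h)] at this
    linarith
  · simp [h]
  · have h1 := hc.slope_le_leftDeriv_of_mem_interior hy hx h
    have h2 := h1.trans (hc.leftDeriv_le_rightDeriv_of_mem_interior hx)
    rw [slope_def_field, div_le_iff₀ (sub_pos.2 h)] at h2
    linarith

/-- The domain of `G` is an interval, so no further regularity is needed to find a subgradient at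
the midpoint of two distinct points. -/
theorem midpoint_mem_interior {s s' : ℝ} (hs : G s ≠ ⊤) (hs' : G s' ≠ ⊤) (h : s ≠ s') :
    (s + s') / 2 ∈ interior {s | G s ≠ ⊤} := by
  wlog hlt : s < s' generalizing s s'
  · rw [add_comm]
    exact this hs' hs h.symm (lt_of_le_of_ne (not_lt.1 hlt) h.symm)
  have hsub : Icc s s' ⊆ {s | G s ≠ ⊤} := hG.convexOn_toReal.1.ordConnected.out hs hs'
  refine interior_mono hsub ?_
  rw [interior_Icc]
  constructor <;> linarith

/-- A subgradient line works, unless the domain is `{0}`, where the zero function does. This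
controls the negative part of `G(m)` by `m ∈ L¹`. -/
theorem exists_affine_minorant : ∃ a b : ℝ, ∀ s, ((a * s + b : ℝ) : EReal) ≤ G s := by
  by_cases h : ∃ s, s ≠ 0 ∧ G s ≠ ⊤
  · obtain ⟨s, h0, hs⟩ := h
    obtain ⟨p, hp⟩ := hG.exists_subgradient
      (hG.midpoint_mem_interior hs (s' := 0) (by simp [hG.zero]) h0)
    refine ⟨p, (G ((s + 0) / 2)).toReal - p * ((s + 0) / 2), fun y =>
      (le_of_eq ?_).trans (hp y)⟩
    rw [EReal.coe_eq_coe_iff]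
    ring
  · push Not at h
    refine ⟨0, 0, fun s => ?_⟩
    by_cases hs : s = 0
    · simp [hs, hG.zero]
    · simp [h s hs]

theorem ne_top_midpoint {s s' : ℝ} (hs : G s ≠ ⊤) (hs' : G s' ≠ ⊤) :
    G ((s + s') / 2) ≠ ⊤ := by
  have h : Convex ℝ {s | G s ≠ ⊤} := hG.convexOn_toReal.1
  have := h.midpoint_mem (x := s) (y := s') hs hs'
  rw [midpoint_eq_smul_add, smul_eq_mul, invOf_eq_inv, ← div_eq_inv_mul] at this
  exact this

/-- Uniform midpoint convexity: a subgradient of `G` at the midpoint of `s` and `s'` is used as the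
dual variable in `QP`. -/
theorem midpoint_le {c : ℝ} (hc : 0 < c) {J Js : ℝ → ℝ} (hQP : QP G c J Js) {s s' : ℝ}
    (hs : G s ≠ ⊤) (hs' : G s' ≠ ⊤) :
    (G ((s + s') / 2)).toReal + c / 4 * (J s - J s') ^ 2 ≤
      ((G s).toReal + (G s').toReal) / 2 := by
  rcases eq_or_ne s s' with rfl | hne
  · have : (s + s) / 2 = s := by ring
    simp [this]
  set z := (s + s') / 2 with hz
  obtain ⟨p, hp⟩ := hG.exists_subgradient (hG.midpoint_mem_interior hs hs' hne)
  -- As `p` is a subgradient at `z`, the supremum defining `G*(p)` is attained at `z`.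
  have hconj : conj G p ≤ ((p * z - (G z).toReal : ℝ) : EReal) := by
    refine iSup_le fun y => ?_
    by_cases hy : G y = ⊤
    · simp [hy]
    have h1 := hp y
    rw [← EReal.coe_toReal hy (hG.ne_bot y)] at h1 ⊢
    rw [EReal.coe_le_coe_iff] at h1
    rw [← EReal.coe_sub, EReal.coe_le_coe_iff, hz]
    linarith
  have key : ∀ s, G s ≠ ⊤ →
      s * p + c * |J s - Js p| ^ 2 ≤ (G s).toReal + (p * z - (G z).toReal) := by
    intro s hs
    have h1 := (hQP s p).trans (add_le_add le_rfl hconj)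
    rw [← EReal.coe_toReal hs (hG.ne_bot s), ← EReal.coe_add, EReal.coe_le_coe_iff] at h1
    simpa using h1
  have h1 := key s hs
  have h2 := key s' hs'
  rw [sq_abs] at h1 h2
  -- Both applications of `QP` share the same `p`, so `J_*(p)` is eliminated by `(a - b)² ≤ 2a² +
  -- 2b²`; with the average over `s, s'` this turns `c` into `c/4`.
  have h3 : (J s - J s') ^ 2 ≤ 2 * (J s - Js p) ^ 2 + 2 * (J s' - Js p) ^ 2 := by
    nlinarith [sq_nonneg ((J s - Js p) + (J s' - Js p))]
  have h4 : c * (J s - J s') ^ 2 ≤ c * (2 * (J s - Js p) ^ 2 + 2 * (J s' - Js p) ^ 2) :=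
    mul_le_mul_of_nonneg_left h3 hc.le
  have h5 : p * z = (s * p + s' * p) / 2 := by rw [hz]; ring
  linarith

theorem measurable : Measurable G := hG.lsc.measurable

/-- By `midpoint_le`, `(J s - J x)²` is bounded by a multiple of the midpoint convexity defect of
`G` between `s` and `x`, which tends to zero because `G` is continuous inside its domain. -/
theorem continuousAt_of_mem_interior {c : ℝ} (hc : 0 < c) {J Js : ℝ → ℝ} (hQP : QP G c J Js)
    {x : ℝ} (hx : x ∈ interior {s | G s ≠ ⊤}) : ContinuousAt J x := by
  have hcont : ∀ y ∈ interior {s | G s ≠ ⊤}, ContinuousAt (fun s => (G s).toReal) y := fun y hy =>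
    hG.convexOn_toReal.continuousOn_interior.continuousAt (isOpen_interior.mem_nhds hy)
  have hmid : ContinuousAt (fun s => (G ((s + x) / 2)).toReal) x := by
    have h2 : (x + x) / 2 = x := by ring
    refine ContinuousAt.comp (g := fun s => (G s).toReal) (f := fun s => (s + x) / 2) ?_
      (by fun_prop)
    rw [h2]
    exact hcont x hx
  have hlim : Filter.Tendsto
      (fun s => 4 / c * (((G s).toReal + (G x).toReal) / 2 - (G ((s + x) / 2)).toReal))
      (nhds x) (nhds 0) := by
    have h2 : (x + x) / 2 = x := by ring
    have h : Filter.Tendsto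
        (fun s => 4 / c * (((G s).toReal + (G x).toReal) / 2 - (G ((s + x) / 2)).toReal)) (nhds x)
        (nhds (4 / c * (((G x).toReal + (G x).toReal) / 2 - (G ((x + x) / 2)).toReal))) :=
      ((((hcont x hx).tendsto.add_const ((G x).toReal)).div_const 2).sub
        hmid.tendsto).const_mul (4 / c)
    rwa [h2, add_self_div_two, sub_self, mul_zero] at h
  have hsq : Filter.Tendsto (fun s => (J s - J x) ^ 2) (nhds x) (nhds 0) := by
    refine squeeze_zero' (.of_forall fun s => sq_nonneg _) ?_ hlim
    filter_upwards [isOpen_interior.mem_nhds hx] with s hs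
    have := hG.midpoint_le hc hQP (interior_subset hs) (interior_subset hx)
    rw [div_mul_eq_mul_div, le_div_iff₀ hc]
    linarith
  have habs : Filter.Tendsto (fun s => |J s - J x|) (nhds x) (nhds 0) := by
    have := (Real.continuous_sqrt.tendsto 0).comp hsq
    simpa [Function.comp_def, Real.sqrt_sq_eq_abs] using this
  rw [ContinuousAt, tendsto_iff_dist_tendsto_zero]
  simpa [Real.dist_eq] using habs

/-- A point of an interval that is neither its least nor its greatest element is interior, so at
most two points are left. -/
theorem countable_diff_interior : ({s | G s ≠ ⊤} \ interior {s | G s ≠ ⊤}).Countable := by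
  set D := {s | G s ≠ ⊤}
  have hD : OrdConnected D := hG.convexOn_toReal.1.ordConnected
  have hsub : D \ interior D ⊆ {x | IsLeast D x} ∪ {x | IsGreatest D x} := by
    rintro x ⟨hx, hxi⟩
    by_contra hcon
    simp only [mem_union, mem_ofPred_eq, not_or, IsLeast, IsGreatest, hx, true_and, lowerBounds,
      upperBounds, not_forall, not_le] at hcon
    obtain ⟨⟨a, ha, hax⟩, b, hb, hxb⟩ := hcon
    refine hxi (interior_mono (hD.out ha hb) ?_)
    rw [interior_Icc]
    exact ⟨hax, hxb⟩
  refine Countable.mono hsub (Countable.union ?_ ?_)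
  · exact Set.Subsingleton.countable fun x hx y hy => hx.unique hy
  · exact Set.Subsingleton.countable fun x hx y hy => hx.unique hy

/-- On the domain of `G`, the function `J` agrees with a Borel function. -/
theorem exists_measurable_eq {c : ℝ} (hc : 0 < c) {J Js : ℝ → ℝ} (hQP : QP G c J Js) :
    ∃ J' : ℝ → ℝ, Measurable J' ∧ ∀ s, G s ≠ ⊤ → J' s = J s := by
  set D := {s | G s ≠ ⊤} with hDdef
  have h1 : Measurable ((interior D).indicator J) := by
    classical
    rw [← piecewise_eq_indicator]
    refine ((ContinuousOn.measurable_piecewise (f := J) (g := 0) ?_ continuousOn_const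
      isOpen_interior.measurableSet) : _)
    exact fun x hx => (hG.continuousAt_of_mem_interior hc hQP hx).continuousWithinAt
  have h2 : Measurable ((D \ interior D).indicator J) :=
    (measurable_zero (α := ℝ) (β := ℝ)).measurable_of_countable_ne
      (hG.countable_diff_interior.mono fun x hx => by
        by_contra hcon
        exact hx (indicator_of_notMem hcon J).symm)
  refine ⟨_, h1.add h2, fun s hs => ?_⟩
  by_cases hsi : s ∈ interior D
  · simp [hsi]
  · have : s ∈ D \ interior D := ⟨hs, hsi⟩
    rw [Pi.add_apply, indicator_of_notMem hsi, indicator_of_mem this, zero_add]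

end IsPenalization

/-! ### Weakly continuous representatives and the final measure -/

theorem exists_continuousOn_ae_eq_of_weak_deriv {T : ℝ} (hT : 0 < T) {g h : ℝ → ℝ}
    (hg : IntegrableOn g (Ioo 0 T)) (hh : IntegrableOn h (Ioo 0 T)) (c₀ : ℝ)
    (H : ∀ η : ℝ → ℝ, ContDiff ℝ 1 η → (∃ τ < T, ∀ t, τ ≤ t → η t = 0) →
      (∫ t in Ioo 0 T, (g t * deriv η t + h t * η t)) + η 0 * c₀ = 0) :
    ∃ F : ℝ → ℝ, ContinuousOn F (Icc 0 T) ∧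
      ∀ᵐ t ∂(volume.restrict (Ioo 0 T)), F t = g t := by
  have hhi : IntervalIntegrable h volume 0 T := by
    rw [intervalIntegrable_iff_integrableOn_Ioo_of_le hT.le]
    exact hh
  set P : ℝ → ℝ := fun t => ∫ s in (0 : ℝ)..t, h s with hP
  have hPac : AbsolutelyContinuousOnInterval P 0 T :=
    hhi.absolutelyContinuousOnInterval_intervalIntegral left_mem_uIcc
  have hPc : ContinuousOn P (Icc 0 T) := by
    have := hPac.continuousOn
    rwa [uIcc_of_le hT.le] at this
  -- The hypothesis says that weakly `g' = h` and `g(0) = c₀`, so the candidate is the primitive of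
  -- `h` started at `c₀`.
  have hFc : ContinuousOn (fun t => P t + c₀) (Icc 0 T) := hPc.add continuousOn_const
  refine ⟨fun t => P t + c₀, hFc, ?_⟩
  have hFi : IntegrableOn (fun t => P t + c₀) (Ioo 0 T) :=
    (hFc.integrableOn_Icc).mono_set Ioo_subset_Icc_self
  have hzero := isOpen_Ioo.ae_eq_zero_of_integral_contDiff_smul_eq_zero
    (f := fun t => P t + c₀ - g t) (U := Ioo 0 T) (μ := volume)
    ((hFi.sub hg).locallyIntegrableOn) ?_
  · rw [ae_restrict_iff' measurableSet_Ioo]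
    filter_upwards [hzero] with t ht hmem
    exact sub_eq_zero.1 (ht hmem)
  intro ψ hψ hψc hψs
  obtain ⟨τ, hτT, hτ⟩ : ∃ τ < T, ∀ t, τ < t → ψ t = 0 := by
    rcases (tsupport ψ).eq_empty_or_nonempty with he | hne
    · exact ⟨0, hT, fun t _ => image_eq_zero_of_notMem_tsupport (by simp [he])⟩
    · obtain ⟨τ, hτ, hmax⟩ := hψc.isCompact.exists_isGreatest hne
      exact ⟨τ, (hψs hτ).2, fun t ht => image_eq_zero_of_notMem_tsupport
        fun hmem => (not_le.2 ht) (hmax hmem)⟩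
  -- The primitive of `ψ` that vanishes at `T` also vanishes on `[τ,∞)`, hence is an allowed test
  -- function. It need not vanish at `0`: `η 0 = -∫ ψ` is what brings in `c₀`.
  set η : ℝ → ℝ := fun t => ∫ s in T..t, ψ s with hη
  have hηd : ∀ t, HasDerivAt η (ψ t) t := fun t =>
    (hψ.continuous).integral_hasStrictDerivAt T t |>.hasDerivAt
  have hηderiv : deriv η = ψ := funext fun t => (hηd t).deriv
  have hη1 : ContDiff ℝ 1 η := by
    rw [contDiff_one_iff_deriv, hηderiv]
    exact ⟨fun t => (hηd t).differentiableAt, hψ.continuous⟩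
  have hη0 : ∀ t, τ ≤ t → η t = 0 := by
    intro t ht
    rw [hη]
    refine intervalIntegral.integral_zero_ae (Filter.Eventually.of_forall fun s hs => hτ s ?_)
    exact lt_of_le_of_lt (le_min hτT.le ht) hs.1
  have hmain := H η hη1 ⟨τ, hτT, hη0⟩
  rw [hηderiv] at hmain
  have hηac : AbsolutelyContinuousOnInterval η 0 T :=
    hη1.contDiffOn.absolutelyContinuousOnInterval
  have hparts := hηac.integral_mul_deriv_eq_deriv_mul hPac
  have hηT : η T = 0 := hη0 T hτT.le
  have hP0 : P 0 = 0 := by simp [hP]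
  rw [hηT, hP0, hηderiv, zero_mul, mul_zero, sub_zero, zero_sub] at hparts
  have hl : ∫ t in (0 : ℝ)..T, η t * deriv P t = ∫ t in (0 : ℝ)..T, h t * η t := by
    refine intervalIntegral.integral_congr_ae ?_
    filter_upwards [hhi.ae_hasDerivAt_integral] with t ht hmem
    rw [(ht (uIoc_subset_uIcc hmem) 0 left_mem_uIcc).deriv, mul_comm]
  rw [hl, intervalIntegral.integral_of_le hT.le, intervalIntegral.integral_of_le hT.le,
    integral_Ioc_eq_integral_Ioo, integral_Ioc_eq_integral_Ioo] at hparts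
  have hψb : ∃ C, ∀ t, ‖ψ t‖ ≤ C := hψc.exists_bound_of_continuous hψ.continuous
  obtain ⟨C, hC⟩ := hψb
  have hgψ : IntegrableOn (fun t => g t * ψ t) (Ioo 0 T) :=
    hg.mul_bdd hψ.continuous.aestronglyMeasurable (.of_forall hC)
  have hPψ : IntegrableOn (fun t => ψ t * P t) (Ioo 0 T) :=
    ((hPc.integrableOn_Icc).mono_set Ioo_subset_Icc_self).bdd_mul
      hψ.continuous.aestronglyMeasurable (.of_forall hC)
  have hηi : IntegrableOn (fun t => h t * η t) (Ioo 0 T) := by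
    have := hhi.mul_continuousOn (hη1.continuous.continuousOn (s := uIcc 0 T))
    rwa [intervalIntegrable_iff_integrableOn_Ioo_of_le hT.le] at this
  have hψi : IntegrableOn ψ (Ioo 0 T) :=
    hψ.continuous.integrableOn_Icc.mono_set Ioo_subset_Icc_self
  have hη00 : η 0 = -∫ t in Ioo 0 T, ψ t := by
    rw [hη]
    simp only
    rw [intervalIntegral.integral_symm, intervalIntegral.integral_of_le hT.le,
      integral_Ioc_eq_integral_Ioo]
  rw [integral_add hgψ hηi, hparts, hη00] at hmain
  have hsupp : ∫ t, ψ t • (P t + c₀ - g t) = ∫ t in Ioo 0 T, ψ t • (P t + c₀ - g t) := by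
    rw [setIntegral_eq_integral_of_forall_compl_eq_zero]
    intro t ht
    rw [image_eq_zero_of_notMem_tsupport fun hmem => ht (hψs hmem), zero_smul]
  have hsplit : ∀ t, ψ t • (P t + c₀ - g t) = ψ t * P t + ψ t * c₀ - g t * ψ t := fun t => by
    simp only [smul_eq_mul]; ring
  rw [hsupp]
  simp_rw [hsplit]
  have hPψ' := hPψ.add (hψi.mul_const c₀)
  have e1 := integral_sub hPψ' hgψ
  simp only [Pi.add_apply] at e1
  rw [e1, integral_add hPψ (hψi.mul_const c₀), integral_mul_const]
  linarith

/-- Real and imaginary parts of the Fourier monomials. -/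
noncomputable def trig (k : (Fin d → ℤ) × Bool) : C(Torus d, ℝ) where
  toFun x := if k.2 then (UnitAddTorus.mFourier k.1 x).re else (UnitAddTorus.mFourier k.1 x).im
  continuous_toFun := by
    cases k.2
    · exact Complex.continuous_im.comp (UnitAddTorus.mFourier k.1).continuous
    · exact Complex.continuous_re.comp (UnitAddTorus.mFourier k.1).continuous

theorem contDiff_trig (k : (Fin d → ℤ) × Bool) {n : ℕ∞} :
    ContDiff ℝ n fun x : E d => trig k (proj x) := by
  have h : ContDiff ℝ n fun x : E d => UnitAddTorus.mFourier k.1 (proj x) := by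
    simp only [UnitAddTorus.mFourier, ContinuousMap.coe_mk, proj, fourier_coe_apply]
    refine contDiff_prod fun i _ => ?_
    have hi : ContDiff ℝ n fun x : E d => ((x i : ℝ) : ℂ) :=
      Complex.ofRealCLM.contDiff.comp (contDiff_euclidean.1 contDiff_id i)
    exact ((contDiff_const.mul hi).div_const _).cexp
  rcases k with ⟨k, b⟩
  cases b
  · exact Complex.imCLM.contDiff.comp h
  · exact Complex.reCLM.contDiff.comp h

/-- Dominated convergence. It extends integral identities to uniform limits: from Fourier
polynomials to all continuous functions, and from a countable family of test functions to all of
them. -/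
theorem continuous_integral_continuousMap {X Y Z : Type*} [TopologicalSpace X] [CompactSpace X]
    [MeasurableSpace X] {μ : Measure X} [NormedAddCommGroup Y] [NormedAddCommGroup Z]
    [NormedSpace ℝ Z] {B : X → Y → Z} {b : X → ℝ} (hB : ∀ x, Continuous (B x))
    (hb : Integrable b μ) (hBb : ∀ x y, ‖B x y‖ ≤ b x * ‖y‖)
    (hmeas : ∀ F : C(X, Y), AEStronglyMeasurable (fun x => B x (F x)) μ) :
    Continuous fun F : C(X, Y) => ∫ x, B x (F x) ∂μ := by
  rw [continuous_iff_continuousAt]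
  intro F₀
  refine continuousAt_of_dominated (bound := fun x => ‖b x‖ * (‖F₀‖ + 1)) (.of_forall hmeas) ?_
    (hb.norm.mul_const _) (.of_forall fun x => ?_)
  · filter_upwards [Metric.ball_mem_nhds F₀ one_pos] with F hF
    refine .of_forall fun x => (hBb x _).trans ?_
    refine mul_le_mul (le_abs_self _) ?_ (norm_nonneg _) (norm_nonneg _)
    have h1 : ‖F - F₀‖ < 1 := by rwa [← dist_eq_norm]
    have h2 := F.norm_coe_le_norm x
    have h3 := norm_le_insert' F F₀
    linarith
  · exact ((hB x).comp (ContinuousEvalConst.continuous_eval_const x)).continuousAt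

/-- The functions with equal integrals against both measures form a closed subspace containing the
Fourier monomials, whose span is dense. -/
theorem ext_of_integral_trig {μ ν : ProbabilityMeasure (Torus d)}
    (h : ∀ k, ∫ x, trig k x ∂(μ : Measure (Torus d)) = ∫ x, trig k x ∂(ν : Measure (Torus d))) :
    μ = ν := by
  have hint : ∀ (ρ : ProbabilityMeasure (Torus d)) (f : C(Torus d, ℂ)),
      Integrable f (ρ : Measure (Torus d)) := fun ρ f =>
    f.continuous.integrable_of_hasCompactSupport (HasCompactSupport.of_compactSpace f)
  have hcont : ∀ ρ : ProbabilityMeasure (Torus d),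
      Continuous fun f : C(Torus d, ℂ) => ∫ x, f x ∂(ρ : Measure (Torus d)) := fun ρ =>
    continuous_integral_continuousMap (B := fun _ y => y) (b := fun _ => 1)
      (fun _ => continuous_id) (integrable_const _) (fun _ y => by simp)
      fun F => (hint ρ F).aestronglyMeasurable
  let S : Submodule ℂ C(Torus d, ℂ) :=
    { carrier := {f | ∫ x, f x ∂(μ : Measure (Torus d)) = ∫ x, f x ∂(ν : Measure (Torus d))}
      add_mem' := fun {f g} hf hg => by
        simp only [mem_ofPred_eq, ContinuousMap.add_apply] at *
        rw [integral_add (hint μ f) (hint μ g), integral_add (hint ν f) (hint ν g), hf, hg]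
      zero_mem' := by simp
      smul_mem' := fun a f hf => by
        simp only [mem_ofPred_eq, ContinuousMap.smul_apply] at *
        rw [integral_smul, integral_smul, hf] }
  have hS : IsClosed (S : Set C(Torus d, ℂ)) := isClosed_eq (hcont μ) (hcont ν)
  have htop : S = ⊤ := by
    rw [eq_top_iff, ← UnitAddTorus.span_mFourier_closure_eq_top]
    refine Submodule.topologicalClosure_minimal _ (Submodule.span_le.2 ?_) hS
    rintro _ ⟨k, rfl⟩
    change ∫ x, UnitAddTorus.mFourier k x ∂(μ : Measure (Torus d)) =
      ∫ x, UnitAddTorus.mFourier k x ∂(ν : Measure (Torus d))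
    rw [← integral_re_add_im (hint μ _), ← integral_re_add_im (hint ν _)]
    exact congrArg₂ (fun a b : ℝ => (a : ℂ) + (b : ℂ) * Complex.I) (h (k, true)) (h (k, false))
  refine Subtype.ext ?_
  have : IsFiniteMeasure μ.val := inferInstanceAs (IsFiniteMeasure (μ : Measure (Torus d)))
  have : IsFiniteMeasure ν.val := inferInstanceAs (IsFiniteMeasure (ν : Measure (Torus d)))
  refine (ext_of_forall_integral_eq_of_IsFiniteMeasure fun f => ?_)
  have hf : (Complex.ofRealCLM : C(ℝ, ℂ)).comp f.toContinuousMap ∈ S := htop ▸ Submodule.mem_top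
  have hf' : ∫ x, ((f x : ℝ) : ℂ) ∂(μ : Measure (Torus d)) =
    ∫ x, ((f x : ℝ) : ℂ) ∂(ν : Measure (Torus d)) := hf
  rw [integral_complex_ofReal, integral_complex_ofReal] at hf'
  exact_mod_cast hf'

theorem ae_slice {T : ℝ} {p : ℝ × Torus d → Prop} (h : ∀ᵐ q ∂(cyl d T), p q) :
    ∀ᵐ t ∂(volume.restrict (Ioo 0 T)), ∀ᵐ x, p (t, x) :=
  Measure.ae_ae_of_ae_prod h

namespace Admissible

variable {T : ℝ} {m₀ : Measure (Torus d)} {m : ℝ × Torus d → ℝ} {v : ℝ × Torus d → E d}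

theorem ae_integrable_slice (h : Admissible T m₀ m v) :
    ∀ᵐ t ∂(volume.restrict (Ioo 0 T)), Integrable fun x => m (t, x) :=
  h.integrable.prod_right_ae

/-- Testing the continuity equation with `η(t) f(x)` shows that `t ↦ ∫ m f` has the integrable weak
derivative `∫ m v · ∇f`. -/
theorem exists_continuousOn_integral (hT : 0 < T) (h : Admissible T m₀ m v) {f : Torus d → ℝ}
    (hf : ContDiff ℝ 1 fun x : E d => f (proj x)) :
    ∃ F : ℝ → ℝ, ContinuousOn F (Icc 0 T) ∧
      ∀ᵐ t ∂(volume.restrict (Ioo 0 T)), F t = ∫ x, m (t, x) * f x := by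
  have hone : IsC1SpaceTime fun q : ℝ × Torus d => q.1 * f q.2 := isC1SpaceTime_mul contDiff_id hf
  have hder : ∀ q : ℝ × Torus d, deriv (fun s : ℝ => s * f q.2) q.1 = f q.2 := fun q => by
    simp
  have hconst : IsC1SpaceTime fun q : ℝ × Torus d => 1 * f q.2 :=
    isC1SpaceTime_mul contDiff_const hf
  have hi1 : Integrable (fun q => m q * f q.2) (cyl d T) := by
    simpa only [hder] using (h.integrable_test hone).1
  have hi2 : Integrable (fun q => inner ℝ (m q • v q) (torusGrad f q.2)) (cyl d T) := by
    simpa only [one_mul] using (h.integrable_test hconst).2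
  refine exists_continuousOn_ae_eq_of_weak_deriv hT (g := fun t => ∫ x, m (t, x) * f x)
    (h := fun t => ∫ x, inner ℝ (m (t, x) • v (t, x)) (torusGrad f x)) hi1.integral_prod_left
    hi2.integral_prod_left (∫ x, f x ∂m₀) fun η hη hητ => ?_
  obtain ⟨τ, hτ, hη0⟩ := hητ
  have hφ := isC1SpaceTime_mul hη hf
  have key := h.continuity _ hφ ⟨τ, hτ, fun t ht x => by simp [hη0 t ht]⟩
  simp only [integral_const_mul] at key
  have hint := (h.integrable_test hφ).1.add (h.integrable_test hφ).2
  have hslice := integral_prod (E := ℝ) (μ := volume.restrict (Ioo 0 T)) _ hint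
  simp only [Pi.add_apply] at hslice
  refine Eq.trans ?_ key
  congr 1
  refine Eq.trans ?_ hslice.symm
  refine integral_congr_ae ?_
  have hs1 := (h.integrable_test hφ).1.prod_right_ae
  have hs2 := (h.integrable_test hφ).2.prod_right_ae
  filter_upwards [hs1, hs2] with t ht1 ht2
  rw [integral_add ht1 ht2]
  congr 1
  · rw [← integral_mul_const]
    refine integral_congr_ae (.of_forall fun x => ?_)
    have : deriv (fun s => η s * f x) t = deriv η t * f x :=
      deriv_mul_const (hη.differentiable one_ne_zero t) _
    simp only [this]
    ring
  · rw [← integral_mul_const]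
    refine integral_congr_ae (.of_forall fun x => ?_)
    simp only [torusGrad_const_mul (η t) hf, inner_smul_right]
    ring

/-- Almost every time slice of an admissible density is a probability measure. -/
theorem ae_exists_probabilityMeasure (h : Admissible T m₀ m v) :
    ∀ᵐ t ∂(volume.restrict (Ioo 0 T)), ∃ ρ : ProbabilityMeasure (Torus d),
      (ρ : Measure (Torus d)) = volume.withDensity (fun x => ENNReal.ofReal (m (t, x))) := by
  filter_upwards [ae_slice h.nonneg, h.mass, h.ae_integrable_slice] with t h0 h1 hi
  refine ⟨⟨volume.withDensity (fun x => ENNReal.ofReal (m (t, x))), ⟨?_⟩⟩, rfl⟩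
  rw [withDensity_apply _ MeasurableSet.univ, Measure.restrict_univ,
    ← ofReal_integral_eq_lintegral_ofReal hi h0, h1, ENNReal.ofReal_one]

theorem ae_integral_withDensity (h : Admissible T m₀ m v) :
    ∀ᵐ t ∂(volume.restrict (Ioo 0 T)), ∀ f : Torus d → ℝ,
      ∫ x, f x ∂(volume.withDensity fun x => ENNReal.ofReal (m (t, x))) =
        ∫ x, m (t, x) * f x := by
  filter_upwards [ae_slice h.nonneg, h.ae_integrable_slice] with t h0 hi f
  rw [integral_withDensity_eq_integral_toReal_smul₀ hi.aestronglyMeasurable.aemeasurable.ennreal_ofReal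
    (.of_forall fun _ => ENNReal.ofReal_lt_top)]
  refine integral_congr_ae ?_
  filter_upwards [h0] with x hx
  rw [ENNReal.toReal_ofReal hx, smul_eq_mul]

/-- On the compact space of probability measures the trigonometric moments form a continuous
injective map `Φ` into a product of lines, hence a closed embedding. Each moment of `m(t,·)` has a
continuous version in `t`. The resulting curve lies in the range of `Φ` for a.e. `t`, hence for
every `t ∈ [0,T]` by closedness, and it is pulled back by `Φ`. -/
theorem exists_isContinuousRepresentative (hT : 0 < T) (h : Admissible T m₀ m v) :
    ∃ μ : ℝ → ProbabilityMeasure (Torus d), IsContinuousRepresentative T m μ := by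
  let Φ : ProbabilityMeasure (Torus d) → ((Fin d → ℤ) × Bool) → ℝ :=
    fun μ k => ∫ x, trig k x ∂(μ : Measure (Torus d))
  have hΦc : Continuous Φ := continuous_pi fun k =>
    ProbabilityMeasure.continuous_integral_boundedContinuousFunction
      (BoundedContinuousFunction.mkOfCompact (trig k))
  have hΦi : Function.Injective Φ := fun μ ν hμν => ext_of_integral_trig fun k => congrFun hμν k
  have hΦ := hΦc.isClosedEmbedding hΦi
  choose F hFc hF using fun k : (Fin d → ℤ) × Bool =>
    h.exists_continuousOn_integral hT (contDiff_trig k (n := 1))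
  have hFΦ : ∀ᵐ t ∂(volume.restrict (Ioo 0 T)), ∃ ρ : ProbabilityMeasure (Torus d),
      (ρ : Measure (Torus d)) = volume.withDensity (fun x => ENNReal.ofReal (m (t, x))) ∧
      Φ ρ = fun k => F k t := by
    filter_upwards [h.ae_exists_probabilityMeasure, h.ae_integral_withDensity, ae_all_iff.2 hF]
      with t ⟨ρ, hρ⟩ hint hFt
    refine ⟨ρ, hρ, funext fun k => ?_⟩
    rw [hFt k, ← hint, ← hρ]
  have hFcont : ContinuousOn (fun t k => F k t) (Icc 0 T) := continuousOn_pi.2 hFc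
  have hrange : ∀ t ∈ Icc 0 T, ∃ ρ, Φ ρ = fun k => F k t := by
    intro t ht
    -- Times outside `(0,T)` belong to `A` vacuously, so `A` has full measure in `ℝ` and is dense.
    set A := {t | t ∈ Ioo 0 T → ∃ ρ, Φ ρ = fun k => F k t} with hA
    have hdense : Dense A := by
      refine Measure.dense_of_ae (μ := volume) ?_
      rw [ae_restrict_iff' measurableSet_Ioo] at hFΦ
      filter_upwards [hFΦ] with s hs hmem
      obtain ⟨ρ, -, hρ⟩ := hs hmem
      exact ⟨ρ, hρ⟩
    have hcl : t ∈ closure (Ioo 0 T ∩ A) := by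
      have := hdense.open_subset_closure_inter (isOpen_Ioo (a := (0 : ℝ)) (b := T))
      refine closure_minimal this isClosed_closure ?_
      rwa [closure_Ioo hT.ne]
    have hsub : Ioo 0 T ∩ A ⊆ Icc 0 T := inter_subset_left.trans Ioo_subset_Icc_self
    have := ((hFcont t ht).mono hsub).mem_closure_image hcl
    refine closure_minimal ?_ hΦ.isClosed_range this
    rintro _ ⟨s, ⟨hs, hsA⟩, rfl⟩
    exact hsA hs
  obtain ⟨ρ₀, -⟩ := hrange 0 (left_mem_Icc.2 hT.le)
  have hex : ∀ t, ∃ ρ, t ∈ Icc 0 T → Φ ρ = fun k => F k t := fun t => by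
    by_cases ht : t ∈ Icc 0 T
    · obtain ⟨ρ, hρ⟩ := hrange t ht
      exact ⟨ρ, fun _ => hρ⟩
    · exact ⟨ρ₀, fun h => absurd h ht⟩
  choose μ hμ using hex
  refine ⟨μ, ?_, ?_⟩
  · rw [hΦ.isInducing.continuousOn_iff]
    exact hFcont.congr hμ
  · filter_upwards [hFΦ, ae_restrict_mem measurableSet_Ioo] with t ⟨ρ, hρ, hρF⟩ ht
    rw [← hρ, hΦi ((hμ t (Ioo_subset_Icc_self ht)).trans hρF.symm)]

theorem exists_finalMeasure_eq (hT : 0 < T) (h : Admissible T m₀ m v) :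
    ∃ μ : ℝ → ProbabilityMeasure (Torus d), IsContinuousRepresentative T m μ ∧
      finalMeasure T m = μ T := by
  have hex := h.exists_isContinuousRepresentative hT
  refine ⟨hex.choose, hex.choose_spec, ?_⟩
  rw [finalMeasure, dif_pos hex]

/-- Continuous functions that agree a.e. on `[a,T]` agree at `T`. So the chosen representative never
has to be identified, and knowledge of `m` on `[a,T]` suffices; this matters for shifts that are
constant only after `t₁`. -/
theorem integral_finalMeasure_eq {a : ℝ} (ha : 0 ≤ a) (haT : a < T) (h : Admissible T m₀ m v)
    {f : Torus d → ℝ} (hf : Continuous f) {F : ℝ → ℝ} (hF : ContinuousOn F (Icc a T))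
    (hFm : ∀ᵐ t ∂(volume.restrict (Ioo 0 T)), a ≤ t → F t = ∫ x, m (t, x) * f x) :
    ∫ x, f x ∂(finalMeasure T m) = F T := by
  obtain ⟨μ, ⟨hμc, hμ⟩, hfin⟩ := h.exists_finalMeasure_eq (ha.trans_lt haT)
  rw [hfin]
  have hc1 : ContinuousOn (fun t => ∫ x, f x ∂(μ t : Measure (Torus d))) (Icc a T) :=
    (ProbabilityMeasure.continuous_integral_boundedContinuousFunction
      (BoundedContinuousFunction.mkOfCompact ⟨f, hf⟩)).comp_continuousOn
      (hμc.mono (Icc_subset_Icc_left ha))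
  have hae : ∀ᵐ t ∂(volume.restrict (Ioo 0 T)), a ≤ t →
      ∫ x, f x ∂(μ t : Measure (Torus d)) = F t := by
    filter_upwards [hFm, hμ, h.ae_integral_withDensity] with t h1 h2 h3 hat
    rw [h1 hat, h2, h3]
  have hae' : (fun t => ∫ x, f x ∂(μ t : Measure (Torus d))) =ᵐ[volume.restrict (Icc a T)] F := by
    rw [Filter.EventuallyEq, ← Measure.restrict_congr_set Ioo_ae_eq_Icc,
      ae_restrict_iff' measurableSet_Ioo]
    rw [ae_restrict_iff' measurableSet_Ioo] at hae
    filter_upwards [hae] with t ht hmem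
    exact ht ⟨ha.trans_lt hmem.1, hmem.2⟩ hmem.1.le
  exact Measure.eqOn_Icc_of_ae_eq volume haT.ne hae' hc1 hF (right_mem_Icc.2 haT.le)

end Admissible

/-! ### Competitors: time-dependent translations and averages -/

/-- The homeomorphism `(t, x) ↦ (t, x + ζ(t) δ)` of `ℝ × 𝕋^d`. -/
noncomputable def shift (ζ : ℝ → ℝ) (hζ : Continuous ζ) (δ : E d) :
    (ℝ × Torus d) ≃ₜ (ℝ × Torus d) where
  toFun q := (q.1, q.2 + proj (ζ q.1 • δ))
  invFun q := (q.1, q.2 - proj (ζ q.1 • δ))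
  left_inv q := by simp
  right_inv q := by simp
  continuous_toFun := continuous_fst.prodMk (continuous_snd.add (continuous_proj.comp
    ((hζ.comp continuous_fst).smul continuous_const)))
  continuous_invFun := continuous_fst.prodMk (continuous_snd.sub (continuous_proj.comp
    ((hζ.comp continuous_fst).smul continuous_const)))

theorem shift_apply (ζ : ℝ → ℝ) (hζ : Continuous ζ) (δ : E d) (q : ℝ × Torus d) :
    shift ζ hζ δ q = (q.1, q.2 + proj (ζ q.1 • δ)) := rfl

theorem measurePreserving_shift (ζ : ℝ → ℝ) (hζ : Continuous ζ) (δ : E d) (ν : Measure ℝ)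
    [SFinite ν] : MeasurePreserving (shift ζ hζ δ) (ν.prod volume) (ν.prod volume) := by
  refine (MeasurePreserving.id ν).skew_product
    (g := fun t (x : Torus d) => x + proj (ζ t • δ)) ?_ (.of_forall fun t => ?_)
  · exact (continuous_snd.comp (shift ζ hζ δ).continuous).measurable
  · exact map_add_right_eq_self volume _

theorem measurableEmbedding_shift (ζ : ℝ → ℝ) (hζ : Continuous ζ) (δ : E d) :
    MeasurableEmbedding (shift ζ hζ δ) := (shift ζ hζ δ).measurableEmbedding

theorem measurePreserving_shift_cyl (ζ : ℝ → ℝ) (hζ : Continuous ζ) (δ : E d) (T : ℝ) :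
    MeasurePreserving (shift ζ hζ δ) (cyl d T) (cyl d T) :=
  measurePreserving_shift ζ hζ δ _

/-- Transport of a velocity field by `shift`. -/
noncomputable def shiftField (ζ : ℝ → ℝ) (hζ : Continuous ζ) (δ : E d)
    (v : ℝ × Torus d → E d) (q : ℝ × Torus d) : E d :=
  v (shift ζ hζ δ q) - deriv ζ q.1 • δ

section TestFunctions

variable {ζ : ℝ → ℝ} {φ : ℝ × Torus d → ℝ}

theorem IsC1SpaceTime.comp_shift (hφ : IsC1SpaceTime φ) (hζ : ContDiff ℝ 1 ζ) (δ : E d) :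
    IsC1SpaceTime fun q => φ (q.1, q.2 - proj (ζ q.1 • δ)) := by
  have : (fun q : ℝ × E d => φ (q.1, proj q.2 - proj (ζ q.1 • δ))) =
      (fun q : ℝ × E d => φ (q.1, proj q.2)) ∘ fun q => (q.1, q.2 - ζ q.1 • δ) := by
    funext q
    simp [proj_sub]
  unfold IsC1SpaceTime
  rw [this]
  refine ContDiff.comp hφ (contDiff_fst.prodMk (contDiff_snd.sub ?_))
  exact (hζ.comp contDiff_fst).smul contDiff_const

/-- The drift of the moving frame produces the extra term, which is exactly what the correction
`-ζ'δ` in `shiftField` contributes. -/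
theorem IsC1SpaceTime.deriv_comp_shift (hφ : IsC1SpaceTime φ) (hζ : ContDiff ℝ 1 ζ) (δ : E d)
    (q : ℝ × Torus d) :
    deriv (fun s => φ (s, (shift ζ hζ.continuous δ q).2 - proj (ζ s • δ))) q.1 =
      deriv (fun s => φ (s, q.2)) q.1 -
        deriv ζ q.1 * inner ℝ δ (torusGrad (fun x => φ (q.1, x)) q.2) := by
  obtain ⟨t, x⟩ := q
  obtain ⟨y, rfl⟩ := proj_surjective x
  have h1 : (fun s => φ (s, (shift ζ hζ.continuous δ (t, proj y)).2 - proj (ζ s • δ))) =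
      (fun q : ℝ × E d => φ (q.1, proj q.2)) ∘ fun s => (s, y + ζ t • δ - ζ s • δ) := by
    funext s
    simp [shift_apply, proj_sub, proj_add]
  have h2 : HasDerivAt (fun s => (s, y + ζ t • δ - ζ s • δ)) ((1 : ℝ), -(deriv ζ t • δ)) t := by
    refine (hasDerivAt_id t).prodMk ?_
    have := (((hζ.differentiable one_ne_zero t).hasDerivAt.smul_const δ).const_sub (y + ζ t • δ))
    exact this
  have h3 := hφ.hasFDerivAt t y
  have h4 : HasFDerivAt (fun q : ℝ × E d => φ (q.1, proj q.2))
      (fderiv ℝ (fun q : ℝ × E d => φ (q.1, proj q.2)) (t, y)) (t, y + ζ t • δ - ζ t • δ) := by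
    simpa using h3
  rw [h1, (h4.comp_hasDerivAt t h2).deriv, real_inner_comm]
  have h5 : ((1 : ℝ), -(deriv ζ t • δ)) = (1, 0) - deriv ζ t • ((0 : ℝ), δ) := by
    simp
  rw [h5, map_sub, map_smul, hφ.deriv_time, hφ.inner_torusGrad, smul_eq_mul]

theorem torusGrad_comp_sub (f : Torus d → ℝ) (a x : Torus d) :
    torusGrad (fun x => f (x - a)) x = torusGrad f (x - a) := by
  unfold torusGrad
  simp only [add_sub_right_comm]

end TestFunctions

namespace Admissible

variable {T : ℝ} {m₀ : Measure (Torus d)} {m n : ℝ × Torus d → ℝ} {v u : ℝ × Torus d → E d}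

theorem shift (h : Admissible T m₀ m v) {ζ : ℝ → ℝ} (hζ : ContDiff ℝ 1 ζ) (hζ0 : ζ 0 = 0)
    (δ : E d) :
    Admissible T m₀ (fun q => m (shift ζ hζ.continuous δ q))
      (shiftField ζ hζ.continuous δ v) := by
  set S := MFG.shift ζ hζ.continuous δ with hS
  have hmp : MeasurePreserving S (cyl d T) (cyl d T) := measurePreserving_shift_cyl ..
  have hemb : MeasurableEmbedding S := measurableEmbedding_shift ..
  have hdζ : Continuous fun q : ℝ × Torus d => deriv ζ q.1 :=
    (hζ.continuous_deriv le_rfl).comp continuous_fst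
  have hm : Integrable (fun q => m (S q)) (cyl d T) :=
    hmp.integrable_comp_of_integrable h.integrable
  refine ⟨hm, ?_, ?_, ?_, ?_, ?_⟩
  · exact (h.measurable_field.comp_quasiMeasurePreserving hmp.quasiMeasurePreserving).sub
      (hdζ.smul continuous_const).aestronglyMeasurable
  · exact hmp.quasiMeasurePreserving.ae h.nonneg
  · filter_upwards [h.mass] with t ht
    exact (integral_add_right_eq_self (fun x => m (t, x)) (proj (ζ t • δ))).trans ht
  · obtain ⟨C, hC⟩ := exists_bound_of_continuous hdζ T
    have h1 : Integrable (fun q => m (S q) • v (S q)) (cyl d T) :=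
      hmp.integrable_comp_of_integrable h.integrable_flux
    have h2 : Integrable (fun q => (m (S q) * deriv ζ q.1) • δ) (cyl d T) :=
      (hm.mul_bdd hdζ.aestronglyMeasurable hC).smul_const δ
    refine (h1.sub h2).congr (.of_forall fun q => ?_)
    simp only [Pi.sub_apply, shiftField, smul_sub, smul_smul, ← hS]
  · rintro φ hφ ⟨τ, hτ, hφτ⟩
    -- The equation for the translate tested with `φ` is the original equation tested with `φ(t, x -
    -- ζ(t)δ)`. Since `ζ 0 = 0`, the initial term is unchanged.
    have key := h.continuity _ (hφ.comp_shift hζ δ) ⟨τ, hτ, fun t ht x => hφτ t ht _⟩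
    simp only [hζ0, zero_smul, proj_zero, sub_zero] at key
    refine Eq.trans ?_ key
    congr 1
    refine Eq.trans ?_ (hmp.integral_comp hemb _)
    refine integral_congr_ae (.of_forall fun q => ?_)
    have e1 := hφ.deriv_comp_shift hζ δ q
    have e2 : torusGrad (fun x => φ ((S q).1, x - proj (ζ (S q).1 • δ))) (S q).2 =
        torusGrad (fun x => φ (q.1, x)) q.2 := by
      rw [torusGrad_comp_sub (fun x => φ ((S q).1, x))]
      simp [hS, shift_apply]
    have e0 : (S q).1 = q.1 := rfl
    simp only [e2]
    simp only [e0]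
    rw [e1]
    simp only [shiftField, ← hS, smul_sub, inner_sub_left, inner_smul_left, conj_trivial]
    ring

/-- Where `m + n = 0` both densities vanish, so the value of the inverse at zero is harmless. -/
theorem flux_midpoint (hm : ∀ᵐ q ∂(cyl d T), 0 ≤ m q) (hn : ∀ᵐ q ∂(cyl d T), 0 ≤ n q) :
    ∀ᵐ q ∂(cyl d T), ((m q + n q) / 2) • ((m q + n q)⁻¹ • (m q • v q + n q • u q)) =
      (1 / 2 : ℝ) • (m q • v q + n q • u q) := by
  filter_upwards [hm, hn] with q h1 h2
  rcases eq_or_ne (m q + n q) 0 with h | h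
  · have h3 : m q = 0 := by linarith
    have h4 : n q = 0 := by linarith
    simp [h3, h4]
  · rw [smul_smul]
    congr 1
    field_simp

/-- The average of two admissible pairs (densities and fluxes are averaged) is admissible. -/
theorem midpoint (h : Admissible T m₀ m v) (h' : Admissible T m₀ n u) :
    Admissible T m₀ (fun q => (m q + n q) / 2)
      (fun q => (m q + n q)⁻¹ • (m q • v q + n q • u q)) := by
  have hflux := flux_midpoint (v := v) (u := u) h.nonneg h'.nonneg
  refine ⟨(h.integrable.add h'.integrable).div_const 2, ?_, ?_, ?_, ?_, ?_⟩
  · refine AEStronglyMeasurable.smul (𝕜 := ℝ) ?_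
      (h.integrable_flux.add h'.integrable_flux).aestronglyMeasurable
    exact (h.integrable.add h'.integrable).aestronglyMeasurable.aemeasurable.inv.aestronglyMeasurable
  · filter_upwards [h.nonneg, h'.nonneg] with q h1 h2
    positivity
  · filter_upwards [h.mass, h'.mass, h.ae_integrable_slice, h'.ae_integrable_slice]
      with t h1 h2 h3 h4
    rw [integral_div, integral_add h3 h4, h1, h2]
    norm_num
  · exact ((h.integrable_flux.add h'.integrable_flux).smul (1 / 2 : ℝ)).congr
      (hflux.mono fun q hq => hq.symm)
  · intro φ hφ hφτ
    have k1 := h.continuity φ hφ hφτ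
    have k2 := h'.continuity φ hφ hφτ
    have i1 := (h.integrable_test hφ).1.add (h.integrable_test hφ).2
    have i2 := (h'.integrable_test hφ).1.add (h'.integrable_test hφ).2
    have hsum : ∫ q, ((m q + n q) / 2 * deriv (fun s => φ (s, q.2)) q.1 +
        inner ℝ (((m q + n q) / 2) • ((m q + n q)⁻¹ • (m q • v q + n q • u q)))
          (torusGrad (fun x => φ (q.1, x)) q.2)) ∂(cyl d T) =
        (1 / 2 : ℝ) * ((∫ q, (m q * deriv (fun s => φ (s, q.2)) q.1
          + inner ℝ (m q • v q) (torusGrad (fun x => φ (q.1, x)) q.2)) ∂(cyl d T)) +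
          ∫ q, (n q * deriv (fun s => φ (s, q.2)) q.1
          + inner ℝ (n q • u q) (torusGrad (fun x => φ (q.1, x)) q.2)) ∂(cyl d T)) := by
      have e := integral_add i1 i2
      simp only [Pi.add_apply] at e
      rw [← e, ← integral_const_mul]
      refine integral_congr_ae ?_
      filter_upwards [hflux] with q hq
      rw [hq]
      simp only [inner_smul_left, inner_add_left, conj_trivial]
      ring
    rw [hsum]
    linarith

end Admissible

/-! ### Energies of the competitors -/

theorem midpoint_kinetic_le {F : Type*} [NormedAddCommGroup F] [NormedSpace ℝ F] {a b : ℝ}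
    (ha : 0 ≤ a) (hb : 0 ≤ b) (v u : F) :
    (a + b) / 2 * ‖(a + b)⁻¹ • (a • v + b • u)‖ ^ 2 / 2 ≤
      (a * ‖v‖ ^ 2 / 2 + b * ‖u‖ ^ 2 / 2) / 2 := by
  rcases (add_nonneg ha hb).eq_or_lt with h | h
  · rw [← h]
    have : 0 ≤ (a * ‖v‖ ^ 2 / 2 + b * ‖u‖ ^ 2 / 2) / 2 := by positivity
    simpa using this
  have h1 : ‖a • v + b • u‖ ≤ a * ‖v‖ + b * ‖u‖ := by
    refine (norm_add_le _ _).trans (le_of_eq ?_)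
    rw [norm_smul, norm_smul, Real.norm_of_nonneg ha, Real.norm_of_nonneg hb]
  -- Cauchy–Schwarz: `(a + b)(a‖v‖² + b‖u‖²) - (a‖v‖ + b‖u‖)² = ab(‖v‖ - ‖u‖)²`.
  have h2 : ‖a • v + b • u‖ ^ 2 ≤ (a + b) * (a * ‖v‖ ^ 2 + b * ‖u‖ ^ 2) := by
    refine (pow_le_pow_left₀ (norm_nonneg _) h1 2).trans ?_
    nlinarith [mul_nonneg (mul_nonneg ha hb) (sq_nonneg (‖v‖ - ‖u‖))]
  rw [norm_smul, mul_pow, norm_inv, Real.norm_of_nonneg h.le]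
  have h3 : (a + b) / 2 * ((a + b)⁻¹ ^ 2 * ‖a • v + b • u‖ ^ 2) / 2 =
      ‖a • v + b • u‖ ^ 2 / (4 * (a + b)) := by
    field_simp; ring
  rw [h3, div_le_iff₀ (by positivity)]
  linarith

variable {T : ℝ}

instance isFiniteMeasure_cyl : IsFiniteMeasure (cyl d T) := by
  unfold cyl; infer_instance

section Congestion

variable {G : ℝ → EReal} {m : ℝ × Torus d → ℝ}

theorem congestion_eq {g : ℝ × Torus d → ℝ} (hg : Integrable g (cyl d T))
    (h : ∀ᵐ q ∂(cyl d T), G (m q) = g q) :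
    congestion T G m = ((∫ q, g q ∂(cyl d T) : ℝ) : EReal) := by
  have h1 : ∫⁻ q, (G (m q)).toENNReal ∂(cyl d T) = ∫⁻ q, ENNReal.ofReal (g q) ∂(cyl d T) :=
    lintegral_congr_ae (h.mono fun q hq => by simp [hq])
  have h2 : ∫⁻ q, (-(G (m q))).toENNReal ∂(cyl d T) =
      ∫⁻ q, ENNReal.ofReal (-g q) ∂(cyl d T) :=
    lintegral_congr_ae (h.mono fun q hq => by
      simp only [hq, ← EReal.coe_neg, EReal.real_coe_toENNReal])
  have h3 : ∫⁻ q, ENNReal.ofReal (g q) ∂(cyl d T) ≠ ⊤ := hg.lintegral_lt_top.ne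
  have h4 : ∫⁻ q, ENNReal.ofReal (-g q) ∂(cyl d T) ≠ ⊤ := hg.neg.lintegral_lt_top.ne
  rw [congestion, h1, h2, integral_eq_lintegral_pos_part_sub_lintegral_neg_part hg, EReal.coe_sub,
    EReal.coe_ennreal_toReal h3, EReal.coe_ennreal_toReal h4]

variable (hG : IsPenalization G) (hm : Integrable m (cyl d T))
include hG hm

theorem IsPenalization.integrable_of_le {u : ℝ × Torus d → ℝ} (hu : Integrable u (cyl d T))
    (h : ∀ᵐ q ∂(cyl d T), G (m q) ≤ u q) :
    Integrable (fun q => (G (m q)).toReal) (cyl d T) ∧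
      (∀ᵐ q ∂(cyl d T), (G (m q)).toReal ≤ u q) ∧
      congestion T G m = ((∫ q, (G (m q)).toReal ∂(cyl d T) : ℝ) : EReal) := by
  obtain ⟨a, b, hab⟩ := hG.exists_affine_minorant
  have hcoe : ∀ᵐ q ∂(cyl d T), G (m q) = (((G (m q)).toReal : ℝ) : EReal) := by
    filter_upwards [h] with q hq
    rw [EReal.coe_toReal (hq.trans_lt (EReal.coe_lt_top _)).ne (hG.ne_bot _)]
  have hle : ∀ᵐ q ∂(cyl d T), (G (m q)).toReal ≤ u q := by
    filter_upwards [h, hcoe] with q hq hc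
    rwa [hc, EReal.coe_le_coe_iff] at hq
  have hge : ∀ᵐ q ∂(cyl d T), a * m q + b ≤ (G (m q)).toReal := by
    filter_upwards [hcoe] with q hc
    have := hab (m q)
    rwa [hc, EReal.coe_le_coe_iff] at this
  have hint : Integrable (fun q => (G (m q)).toReal) (cyl d T) :=
    integrable_of_le_of_le
      (hG.measurable.comp_aemeasurable hm.aemeasurable).ereal_toReal.aestronglyMeasurable
      hge hle ((hm.const_mul a).add (integrable_const b)) hu
  exact ⟨hint, hle, congestion_eq hint hcoe⟩

theorem IsPenalization.lintegral_neg_lt_top :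
    ∫⁻ q, (-(G (m q))).toENNReal ∂(cyl d T) < ⊤ := by
  obtain ⟨a, b, hab⟩ := hG.exists_affine_minorant
  refine lt_of_le_of_lt (lintegral_mono fun q => ?_)
    (((hm.const_mul a).add (integrable_const b)).neg.lintegral_lt_top)
  rw [← EReal.real_coe_toENNReal]
  refine EReal.toENNReal_le_toENNReal ?_
  simp only [Pi.neg_apply, Pi.add_apply, EReal.coe_neg]
  exact EReal.neg_le_neg_iff.2 (hab _)

/-- Finite energy means finite kinetic energy and integrable congestion cost. -/
theorem IsPenalization.of_energy_lt_top {Ψ : Torus d → ℝ} {v : ℝ × Torus d → E d}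
    (h : energy T G Ψ m v < ⊤) :
    kinetic T m v ≠ ⊤ ∧ Integrable (fun q => (G (m q)).toReal) (cyl d T) ∧
      (∀ᵐ q ∂(cyl d T), G (m q) ≠ ⊤) ∧
      congestion T G m = ((∫ q, (G (m q)).toReal ∂(cyl d T) : ℝ) : EReal) := by
  have hneg := hG.lintegral_neg_lt_top hm
  -- In `EReal` one has `⊤ + ⊥ = ⊥`, so `⊥` must be excluded before finiteness of the sum says
  -- anything about its terms.
  have hcong : congestion T G m ≠ ⊥ := by
    rw [congestion, sub_eq_add_neg, Ne, EReal.add_eq_bot_iff, not_or]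
    exact ⟨EReal.coe_ennreal_ne_bot _, by simpa using hneg.ne⟩
  have hkc : ((kinetic T m v : ENNReal) : EReal) + congestion T G m ≠ ⊤ := by
    intro hcon
    rw [energy, hcon, EReal.top_add_coe] at h
    exact lt_irrefl _ h
  have hk : kinetic T m v ≠ ⊤ := by
    intro hcon
    rw [hcon, EReal.coe_ennreal_top, EReal.top_add_of_ne_bot hcong] at hkc
    exact hkc rfl
  have hct : congestion T G m ≠ ⊤ := by
    intro hcon
    rw [hcon, EReal.add_top_of_ne_bot (EReal.coe_ennreal_ne_bot _)] at hkc
    exact hkc rfl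
  have hpos : ∫⁻ q, (G (m q)).toENNReal ∂(cyl d T) ≠ ⊤ := by
    intro hcon
    rw [congestion, hcon, ← EReal.coe_ennreal_toReal hneg.ne, EReal.coe_ennreal_top,
      EReal.top_sub_coe] at hct
    exact hct rfl
  have hmeas : AEMeasurable (fun q => G (m q)) (cyl d T) :=
    hG.measurable.comp_aemeasurable hm.aemeasurable
  have hfin : ∀ᵐ q ∂(cyl d T), G (m q) ≠ ⊤ := by
    filter_upwards [ae_lt_top' hmeas.ereal_toENNReal hpos] with q hq
    exact EReal.toENNReal_ne_top_iff.1 hq.ne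
  have hu : Integrable (fun q => (G (m q)).toENNReal.toReal) (cyl d T) :=
    integrable_toReal_of_lintegral_ne_top hmeas.ereal_toENNReal hpos
  have hle : ∀ᵐ q ∂(cyl d T), G (m q) ≤ (((G (m q)).toENNReal.toReal : ℝ) : EReal) := by
    filter_upwards [hfin] with q hq
    rw [EReal.coe_ennreal_toReal (EReal.toENNReal_ne_top_iff.2 hq), EReal.coe_toENNReal_eq_max]
    exact le_max_right _ _
  obtain ⟨h1, -, h3⟩ := hG.integrable_of_le hm hu hle
  exact ⟨hk, h1, hfin, h3⟩

end Congestion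

theorem congestion_shift (G : ℝ → EReal) (m : ℝ × Torus d → ℝ) (ζ : ℝ → ℝ) (hζ : Continuous ζ)
    (δ : E d) : congestion T G (fun q => m (shift ζ hζ δ q)) = congestion T G m := by
  have hmp := measurePreserving_shift_cyl ζ hζ δ T
  have hemb := measurableEmbedding_shift ζ hζ δ
  rw [congestion, congestion,
    hmp.lintegral_comp_emb hemb (fun q => (G (m q)).toENNReal),
    hmp.lintegral_comp_emb hemb (fun q => (-(G (m q))).toENNReal)]

theorem kinetic_shift (m : ℝ × Torus d → ℝ) (v : ℝ × Torus d → E d) (ζ : ℝ → ℝ)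
    (hζ : Continuous ζ) (δ : E d) :
    kinetic T (fun q => m (shift ζ hζ δ q)) (shiftField ζ hζ δ v) =
      ∫⁻ q, ENNReal.ofReal (m q * ‖v q - deriv ζ q.1 • δ‖ ^ 2 / 2) ∂(cyl d T) := by
  rw [← (measurePreserving_shift_cyl ζ hζ δ T).lintegral_comp_emb
    (measurableEmbedding_shift ζ hζ δ)]
  rfl

/-- Parallelogram identity for the kinetic energies of the two opposite shifts. -/
theorem kinetic_shift_add {m₀ : Measure (Torus d)} {m : ℝ × Torus d → ℝ} {v : ℝ × Torus d → E d}
    (h : Admissible T m₀ m v) {ζ : ℝ → ℝ} (hζ : ContDiff ℝ 1 ζ) (δ : E d) :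
    kinetic T (fun q => m (shift ζ hζ.continuous δ q)) (shiftField ζ hζ.continuous δ v) +
      kinetic T (fun q => m (shift ζ hζ.continuous (-δ) q)) (shiftField ζ hζ.continuous (-δ) v) =
    2 * kinetic T m v + ENNReal.ofReal (‖δ‖ ^ 2) *
      ∫⁻ t in Ioo 0 T, ENNReal.ofReal (deriv ζ t ^ 2) := by
  have hm := h.integrable.aemeasurable
  have hv := h.measurable_field
  have hdζ : Measurable fun q : ℝ × Torus d => deriv ζ q.1 :=
    (hζ.continuous_deriv le_rfl).measurable.comp measurable_fst
  have hmeas : AEMeasurable (fun q => ENNReal.ofReal (m q * ‖v q - deriv ζ q.1 • δ‖ ^ 2 / 2))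
      (cyl d T) :=
    ((hm.mul ((hv.sub (hdζ.aestronglyMeasurable.smul_const δ)).norm.aemeasurable.pow_const
      2)).div_const 2).ennreal_ofReal
  have hmeas' : AEMeasurable (fun q => ENNReal.ofReal (m q * ‖v q‖ ^ 2 / 2)) (cyl d T) :=
    ((hm.mul (hv.norm.aemeasurable.pow_const 2)).div_const 2).ennreal_ofReal
  -- Unit mass of almost every slice removes `m` from the cross term, leaving a bound independent of
  -- the minimizer.
  have hmass : ∫⁻ q, ENNReal.ofReal (deriv ζ q.1 ^ 2) * ENNReal.ofReal (m q) ∂(cyl d T) =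
      ∫⁻ t in Ioo 0 T, ENNReal.ofReal (deriv ζ t ^ 2) := by
    have hmeas2 : AEMeasurable (fun q : ℝ × Torus d =>
        ENNReal.ofReal (deriv ζ q.1 ^ 2) * ENNReal.ofReal (m q)) (cyl d T) :=
      (hdζ.pow_const 2).ennreal_ofReal.aemeasurable.mul hm.ennreal_ofReal
    rw [cyl, lintegral_prod _ hmeas2]
    refine lintegral_congr_ae ?_
    filter_upwards [h.mass, ae_slice h.nonneg, h.ae_integrable_slice] with t h1 h2 h3
    rw [lintegral_const_mul' _ _ ENNReal.ofReal_ne_top, ← ofReal_integral_eq_lintegral_ofReal h3 h2,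
      h1, ENNReal.ofReal_one, mul_one]
  rw [kinetic_shift, kinetic_shift, ← lintegral_add_left' hmeas, ← hmass, kinetic,
    ← lintegral_const_mul' _ _ ENNReal.ofNat_ne_top, ← lintegral_const_mul' _ _ ENNReal.ofReal_ne_top,
    ← lintegral_add_left' (hmeas'.const_mul 2)]
  refine lintegral_congr_ae ?_
  filter_upwards [h.nonneg] with q hq
  have h2 : (2 : ENNReal) * ENNReal.ofReal (m q * ‖v q‖ ^ 2 / 2) =
      ENNReal.ofReal (2 * (m q * ‖v q‖ ^ 2 / 2)) := by
    rw [ENNReal.ofReal_mul (by positivity)]; simp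
  rw [h2, ← ENNReal.ofReal_add (by positivity) (by positivity), ← ENNReal.ofReal_mul (by positivity),
    ← ENNReal.ofReal_mul (by positivity),
    ← ENNReal.ofReal_add (by positivity) (by positivity)]
  congr 1
  have hpar := parallelogram_law_with_norm ℝ (v q) (deriv ζ q.1 • δ)
  have hn : ‖deriv ζ q.1 • δ‖ ^ 2 = deriv ζ q.1 ^ 2 * ‖δ‖ ^ 2 := by
    rw [norm_smul, Real.norm_eq_abs, mul_pow, sq_abs]
  rw [hn] at hpar
  rw [smul_neg, sub_neg_eq_add]
  linear_combination (m q / 2) * hpar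

theorem kinetic_midpoint_le {m n : ℝ × Torus d → ℝ} {v u : ℝ × Torus d → E d}
    (hm : ∀ᵐ q ∂(cyl d T), 0 ≤ m q) (hn : ∀ᵐ q ∂(cyl d T), 0 ≤ n q)
    (hK : kinetic T m v ≠ ⊤) (hK' : kinetic T n u ≠ ⊤)
    (hmeas : AEMeasurable m (cyl d T)) (hmeasv : AEStronglyMeasurable v (cyl d T)) :
    kinetic T (fun q => (m q + n q) / 2) (fun q => (m q + n q)⁻¹ • (m q • v q + n q • u q)) ≤
      ENNReal.ofReal (((kinetic T m v).toReal + (kinetic T n u).toReal) / 2) := by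
  have hmeas' : AEMeasurable (fun q => ENNReal.ofReal (m q * ‖v q‖ ^ 2 / 2)) (cyl d T) :=
    ((hmeas.mul (hmeasv.norm.aemeasurable.pow_const 2)).div_const 2).ennreal_ofReal
  have h2 : ENNReal.ofReal (((kinetic T m v).toReal + (kinetic T n u).toReal) / 2) =
      ENNReal.ofReal (1 / 2) * (kinetic T m v + kinetic T n u) := by
    rw [← ENNReal.toReal_add hK hK', div_eq_inv_mul, ← one_div,
      ENNReal.ofReal_mul (by norm_num), ENNReal.ofReal_toReal (ENNReal.add_ne_top.2 ⟨hK, hK'⟩)]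
  rw [h2, kinetic, kinetic, kinetic, ← lintegral_add_left' hmeas',
    ← lintegral_const_mul' _ _ ENNReal.ofReal_ne_top]
  refine lintegral_mono_ae ?_
  filter_upwards [hm, hn] with q h1 h2
  rw [← ENNReal.ofReal_add (by positivity) (by positivity), ← ENNReal.ofReal_mul (by norm_num)]
  refine ENNReal.ofReal_le_ofReal ((midpoint_kinetic_le h1 h2 _ _).trans (le_of_eq ?_))
  ring

/-- Apply the mean value theorem to `s ↦ f(y + sδ) + f(y - sδ)` on `[0,1]`. Its derivative pairs `δ`
with a gradient increment between points at distance `2s‖δ‖`, whence the constant `2K`. -/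
theorem IsC11.exists_second_difference_le {Ψ : Torus d → ℝ} (hΨ : IsC11 Ψ) :
    ∃ L : ℝ, 0 ≤ L ∧ ∀ (x : Torus d) (δ : E d),
      Ψ (x + proj δ) + Ψ (x - proj δ) - 2 * Ψ x ≤ L * ‖δ‖ ^ 2 := by
  obtain ⟨hC1, K, hK⟩ := hΨ
  refine ⟨2 * K, by positivity, fun x δ => ?_⟩
  obtain ⟨y, rfl⟩ := proj_surjective x
  set f : E d → ℝ := fun x => Ψ (proj x) with hf
  have hfd : ∀ z w : E d, fderiv ℝ f z w = inner ℝ (gradient f z) w := fun z w =>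
    (inner_gradient_left z w).symm
  have hd : ∀ s : ℝ, HasDerivAt (fun s : ℝ => f (y + s • δ) + f (y - s • δ))
      (inner ℝ (gradient f (y + s • δ) - gradient f (y - s • δ)) δ) s := by
    intro s
    have h1 : HasDerivAt (fun s : ℝ => y + s • δ) δ s := by
      simpa using ((hasDerivAt_id s).smul_const δ).const_add y
    have h2 : HasDerivAt (fun s : ℝ => y - s • δ) (-δ) s := by
      simpa using ((hasDerivAt_id s).smul_const δ).const_sub y
    have h3 := ((hC1.differentiable one_ne_zero (y + s • δ)).hasFDerivAt.comp_hasDerivAt s h1).add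
      ((hC1.differentiable one_ne_zero (y - s • δ)).hasFDerivAt.comp_hasDerivAt s h2)
    convert! h3 using 1
    rw [inner_sub_left, ← hfd, ← hfd, map_neg, sub_eq_add_neg]
  obtain ⟨s, hs, hslope⟩ := exists_hasDerivAt_eq_slope _ _ zero_lt_one
    (fun s _ => (hd s).continuousAt.continuousWithinAt) fun s _ => hd s
  have hbound : inner ℝ (gradient f (y + s • δ) - gradient f (y - s • δ)) δ ≤
      2 * K * ‖δ‖ ^ 2 := by
    refine (real_inner_le_norm _ _).trans ?_
    have h1 : ‖gradient f (y + s • δ) - gradient f (y - s • δ)‖ ≤ K * (2 * ‖δ‖) := by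
      rw [← dist_eq_norm]
      refine (hK.dist_le_mul _ _).trans ?_
      refine mul_le_mul_of_nonneg_left ?_ K.2
      rw [dist_eq_norm]
      have : y + s • δ - (y - s • δ) = (2 * s) • δ := by
        rw [mul_smul, two_smul]; abel
      rw [this, norm_smul, Real.norm_of_nonneg (by linarith [hs.1])]
      exact mul_le_mul_of_nonneg_right (by linarith [hs.2]) (norm_nonneg _)
    calc _ ≤ K * (2 * ‖δ‖) * ‖δ‖ := mul_le_mul_of_nonneg_right h1 (norm_nonneg _)
      _ = _ := by ring
  rw [hslope] at hbound
  simp only [one_smul, zero_smul, add_zero, sub_zero, div_one] at hbound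
  simp only [hf, proj_add, proj_sub] at hbound
  linarith

/-- As `ζ' = 0` after `t₁`, the integral of `ζ'²` over `[0,t₁]` bounds the one over `(0,T)` for
every `T`. This makes the final constant independent of `T`. -/
theorem exists_cutoff {t₁ : ℝ} (ht₁ : 0 < t₁) : ∃ (ζ : ℝ → ℝ) (D : ℝ), ContDiff ℝ 1 ζ ∧ ζ 0 = 0 ∧
    (∀ t, t₁ ≤ t → ζ t = 1) ∧ 0 ≤ D ∧
    ∀ T : ℝ, ∫⁻ t in Ioo 0 T, ENNReal.ofReal (deriv ζ t ^ 2) ≤ ENNReal.ofReal D := by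
  set ζ : ℝ → ℝ := fun t => Real.smoothTransition (t / t₁) with hζdef
  have hζ : ContDiff ℝ 1 ζ :=
    (Real.smoothTransition.contDiff (n := 1)).comp (contDiff_id.div_const t₁)
  have h1 : ∀ t, t₁ ≤ t → ζ t = 1 := fun t ht =>
    Real.smoothTransition.one_of_one_le ((one_le_div ht₁).2 ht)
  have hd : ∀ t, t₁ < t → deriv ζ t = 0 := by
    intro t ht
    have : ζ =ᶠ[nhds t] fun _ => 1 := by
      filter_upwards [lt_mem_nhds ht] with s hs using h1 s hs.le
    rw [this.deriv_eq, deriv_const]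
  have hdc : Continuous (fun t => deriv ζ t ^ 2) := (hζ.continuous_deriv le_rfl).pow 2
  have hi : IntegrableOn (fun t => deriv ζ t ^ 2) (Icc 0 t₁) := hdc.integrableOn_Icc
  refine ⟨ζ, ∫ t in Icc 0 t₁, deriv ζ t ^ 2, hζ, by simp [hζdef], h1,
    integral_nonneg fun t => sq_nonneg _, fun T => ?_⟩
  rw [ofReal_integral_eq_lintegral_ofReal hi (.of_forall fun t => sq_nonneg _),
    ← lintegral_indicator measurableSet_Ioo, ← lintegral_indicator measurableSet_Icc]
  refine lintegral_mono fun t => ?_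
  refine indicator_apply_le' (fun ht => ?_) fun _ => zero_le
  by_cases h : t ≤ t₁
  · rw [indicator_of_mem (show t ∈ Icc 0 t₁ from ⟨ht.1.le, h⟩)]
  · simp [hd t (not_le.1 h)]

/-- The final costs of the two opposite shifts compared with the original one. -/
theorem integral_finalMeasure_shift_add_le {m₀ : Measure (Torus d)} {m : ℝ × Torus d → ℝ}
    {v : ℝ × Torus d → E d} (h : Admissible T m₀ m v) {Ψ : Torus d → ℝ} (hΨ : Continuous Ψ)
    {L : ℝ} (hL : ∀ (x : Torus d) (δ : E d),
      Ψ (x + proj δ) + Ψ (x - proj δ) - 2 * Ψ x ≤ L * ‖δ‖ ^ 2)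
    {t₁ : ℝ} (ht₁ : 0 < t₁) (hT : t₁ < T) {ζ : ℝ → ℝ} (hζ : ContDiff ℝ 1 ζ) (hζ0 : ζ 0 = 0)
    (hζ1 : ∀ t, t₁ ≤ t → ζ t = 1) (δ : E d) :
    ∫ x, Ψ x ∂(finalMeasure T fun q => m (shift ζ hζ.continuous δ q)) +
      ∫ x, Ψ x ∂(finalMeasure T fun q => m (shift ζ hζ.continuous (-δ) q)) ≤
      2 * ∫ x, Ψ x ∂(finalMeasure T m) + L * ‖δ‖ ^ 2 := by
  obtain ⟨μ, ⟨hμc, hμ⟩, hfin⟩ := h.exists_finalMeasure_eq (ht₁.trans hT)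
  -- After `t₁` the shift is the fixed translation by `δ`, so the final measure is translated and
  -- `δ` moves onto `Ψ` with the opposite sign.
  have hval : ∀ δ : E d, ∫ x, Ψ x ∂(finalMeasure T fun q => m (shift ζ hζ.continuous δ q)) =
      ∫ x, Ψ (x - proj δ) ∂(μ T : Measure (Torus d)) := by
    intro δ
    have hΨδ : Continuous fun x => Ψ (x - proj δ) := hΨ.comp (continuous_id.sub continuous_const)
    refine (h.shift hζ hζ0 δ).integral_finalMeasure_eq ht₁.le hT hΨ
      (F := fun t => ∫ x, Ψ (x - proj δ) ∂(μ t : Measure (Torus d))) ?_ ?_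
    · exact (ProbabilityMeasure.continuous_integral_boundedContinuousFunction
        (BoundedContinuousFunction.mkOfCompact ⟨_, hΨδ⟩)).comp_continuousOn
        (hμc.mono (Icc_subset_Icc_left ht₁.le))
    · filter_upwards [hμ, h.ae_integral_withDensity] with t h1 h2 ht
      rw [h1, h2, ← integral_add_right_eq_self (fun x => m (t, x) * Ψ (x - proj δ)) (proj δ)]
      simp [shift_apply, hζ1 t ht]
  have hint : ∀ f : Torus d → ℝ, Continuous f → Integrable f (μ T : Measure (Torus d)) :=
    fun f hf => hf.integrable_of_hasCompactSupport (HasCompactSupport.of_compactSpace f)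
  have i1 := hint (fun x => Ψ (x - proj δ)) (hΨ.comp (continuous_id.sub continuous_const))
  have i2 := hint (fun x => Ψ (x + proj δ)) (hΨ.comp (continuous_id.add continuous_const))
  have i3 := (hint Ψ hΨ).const_mul 2
  rw [hval, hval, hfin]
  simp only [proj_neg, sub_neg_eq_add]
  rw [← integral_add i1 i2, ← integral_const_mul]
  have hc : L * ‖δ‖ ^ 2 = ∫ _, L * ‖δ‖ ^ 2 ∂(μ T : Measure (Torus d)) := by simp
  rw [hc, ← integral_add i3 (integrable_const _)]
  refine integral_mono (i1.add i2) (i3.add (integrable_const _)) fun x => ?_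
  have := hL x δ
  simp only
  linarith

theorem integral_finalMeasure_midpoint {m₀ : Measure (Torus d)} {m n : ℝ × Torus d → ℝ}
    {v u : ℝ × Torus d → E d} (hT : 0 < T) (h : Admissible T m₀ m v) (h' : Admissible T m₀ n u)
    {Ψ : Torus d → ℝ} (hΨ : Continuous Ψ) :
    ∫ x, Ψ x ∂(finalMeasure T fun q => (m q + n q) / 2) =
      (∫ x, Ψ x ∂(finalMeasure T m) + ∫ x, Ψ x ∂(finalMeasure T n)) / 2 := by
  obtain ⟨μ, ⟨hμc, hμ⟩, hfin⟩ := h.exists_finalMeasure_eq hT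
  obtain ⟨ν, ⟨hνc, hν⟩, hfin'⟩ := h'.exists_finalMeasure_eq hT
  have hc := ProbabilityMeasure.continuous_integral_boundedContinuousFunction
    (BoundedContinuousFunction.mkOfCompact ⟨Ψ, hΨ⟩)
  rw [hfin, hfin']
  refine (h.midpoint h').integral_finalMeasure_eq le_rfl hT hΨ
    (F := fun t => (∫ x, Ψ x ∂(μ t : Measure (Torus d)) +
      ∫ x, Ψ x ∂(ν t : Measure (Torus d))) / 2) ?_ ?_
  · exact ((hc.comp_continuousOn hμc).add (hc.comp_continuousOn hνc)).div_const 2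
  · obtain ⟨C, hC⟩ := (isCompact_univ (X := Torus d)).exists_bound_of_continuousOn
      hΨ.continuousOn
    filter_upwards [hμ, hν, h.ae_integral_withDensity, h'.ae_integral_withDensity,
      h.ae_integrable_slice, h'.ae_integrable_slice] with t h1 h2 h3 h4 h5 h6 _
    rw [h1, h2, h3, h4, ← integral_add
      (h5.mul_bdd hΨ.aestronglyMeasurable (.of_forall fun x => hC x (mem_univ x)))
      (h6.mul_bdd hΨ.aestronglyMeasurable (.of_forall fun x => hC x (mem_univ x))), ← integral_div]
    refine integral_congr_ae (.of_forall fun x => ?_)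
    simp only
    ring

/-! ### The translation estimate -/

section Estimate

variable {G : ℝ → EReal} {Ψ : Torus d → ℝ} {c : ℝ} {J Js : ℝ → ℝ} {m₀ : Measure (Torus d)}
  {m : ℝ × Torus d → ℝ} {v : ℝ × Torus d → E d}

theorem energy_eq_coe {K A P : ℝ} (hK : 0 ≤ K) (h1 : kinetic T m v = ENNReal.ofReal K)
    (h2 : congestion T G m = A) (h3 : ∫ x, Ψ x ∂(finalMeasure T m) = P) :
    energy T G Ψ m v = ((K + A + P : ℝ) : EReal) := by
  rw [energy, h1, h2, h3, EReal.coe_ennreal_ofReal, max_eq_left hK, EReal.coe_add, EReal.coe_add]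

theorem aestronglyMeasurable_comp (hG : IsPenalization G) (hc : 0 < c) (hQP : QP G c J Js)
    (hm : AEMeasurable m (cyl d T)) (hfin : ∀ᵐ q ∂(cyl d T), G (m q) ≠ ⊤) :
    AEStronglyMeasurable (fun q => J (m q)) (cyl d T) := by
  obtain ⟨J', hJ', heq⟩ := hG.exists_measurable_eq hc hQP
  exact (hJ'.comp_aemeasurable hm).aestronglyMeasurable.congr (hfin.mono fun q hq => heq _ hq)

/-- `midpoint_le` with `s' = 0` and `G 0 = 0` bounds `(J(m) - J(0))²` by an integrable combination
of `G(m)`, `m` and a constant. Adding `J(0)` back is harmless on a finite measure space. -/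
theorem memLp_comp (hG : IsPenalization G) (hc : 0 < c) (hQP : QP G c J Js)
    (hm : Integrable m (cyl d T)) (hfin : ∀ᵐ q ∂(cyl d T), G (m q) ≠ ⊤)
    (hg : Integrable (fun q => (G (m q)).toReal) (cyl d T)) :
    MemLp (fun q => J (m q)) 2 (cyl d T) := by
  have hmeas := aestronglyMeasurable_comp hG hc hQP hm.aemeasurable hfin
  obtain ⟨a, b, hab⟩ := hG.exists_affine_minorant
  have h0 : MemLp (fun q => J (m q) - J 0) 2 (cyl d T) := by
    refine (memLp_two_iff_integrable_sq (hmeas.sub aestronglyMeasurable_const)).2 ?_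
    have hu : Integrable (fun q => 4 / c * ((G (m q)).toReal / 2 - (a * (m q / 2) + b)))
        (cyl d T) :=
      ((hg.div_const 2).sub (((hm.div_const 2).const_mul a).add (integrable_const b))).const_mul _
    refine integrable_of_le_of_le ((hmeas.sub aestronglyMeasurable_const).pow 2)
      (.of_forall fun q => sq_nonneg _) ?_ (integrable_zero _ _ _) hu
    filter_upwards [hfin] with q hq
    have hz : G 0 ≠ ⊤ := by simp [hG.zero]
    have h1 := hG.midpoint_le hc hQP hq hz
    have h2 := hab ((m q + 0) / 2)
    rw [← EReal.coe_toReal (hG.ne_top_midpoint hq hz) (hG.ne_bot _), EReal.coe_le_coe_iff] at h2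
    rw [hG.zero, EReal.toReal_zero, add_zero] at h1
    rw [add_zero] at h2 h1
    simp only [Pi.sub_apply]
    rw [div_mul_eq_mul_div, le_div_iff₀ hc]
    linarith
  exact (h0.add (memLp_const (J 0))).ae_eq (.of_forall fun q => by simp)

/-- The squared `L²` distance between `J(m)` and its shift, by uniform convexity at the midpoint. -/
theorem IsMinimizer.integral_sq_le (hG : IsPenalization G) (hΨ : Continuous Ψ)
    {L : ℝ} (hL : ∀ (x : Torus d) (δ : E d),
      Ψ (x + proj δ) + Ψ (x - proj δ) - 2 * Ψ x ≤ L * ‖δ‖ ^ 2)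
    (hc : 0 < c) (hQP : QP G c J Js) (h : IsMinimizer T G Ψ m₀ m v)
    {t₁ : ℝ} (ht₁ : 0 < t₁) (hT : t₁ < T) {ζ : ℝ → ℝ} (hζ : ContDiff ℝ 1 ζ) (hζ0 : ζ 0 = 0)
    (hζ1 : ∀ t, t₁ ≤ t → ζ t = 1) {D : ℝ} (hD0 : 0 ≤ D)
    (hD : ∫⁻ t in Ioo 0 T, ENNReal.ofReal (deriv ζ t ^ 2) ≤ ENNReal.ofReal D) (δ : E d) :
    ∫ q, (J (m (shift ζ hζ.continuous δ q)) - J (m q)) ^ 2 ∂(cyl d T) ≤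
      2 * (D + L) / c * ‖δ‖ ^ 2 := by
  have hT0 : 0 < T := ht₁.trans hT
  have hadm := h.admissible
  obtain ⟨hK, hg, hfin, hA⟩ := hG.of_energy_lt_top hadm.integrable h.finite
  set K := (kinetic T m v).toReal
  set A := ∫ q, (G (m q)).toReal ∂(cyl d T) with hAdef
  set P := ∫ x, Ψ x ∂(finalMeasure T m)
  have hE : energy T G Ψ m v = ((K + A + P : ℝ) : EReal) :=
    energy_eq_coe ENNReal.toReal_nonneg (ENNReal.ofReal_toReal hK).symm hA rfl
  have hkin := kinetic_shift_add hadm hζ δ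
  set mp : ℝ × Torus d → ℝ := fun q => m (MFG.shift ζ hζ.continuous δ q) with hmp
  set vp := shiftField ζ hζ.continuous δ v
  set mn : ℝ × Torus d → ℝ := fun q => m (MFG.shift ζ hζ.continuous (-δ) q)
  set vn := shiftField ζ hζ.continuous (-δ) v
  have hadmp : Admissible T m₀ mp vp := hadm.shift hζ hζ0 δ
  have hadmn : Admissible T m₀ mn vn := hadm.shift hζ hζ0 (-δ)
  have hkin' : kinetic T mp vp + kinetic T mn vn ≤ ENNReal.ofReal (2 * K + ‖δ‖ ^ 2 * D) := by
    rw [hkin, ENNReal.ofReal_add (by positivity) (by positivity), ENNReal.ofReal_mul (by positivity),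
      ENNReal.ofReal_toReal hK, ENNReal.ofReal_mul (by positivity), ENNReal.ofReal_ofNat]
    gcongr
  have hsum := ne_top_of_le_ne_top ENNReal.ofReal_ne_top hkin'
  obtain ⟨hKp, hKn⟩ := ENNReal.add_ne_top.1 hsum
  have hkreal : (kinetic T mp vp).toReal + (kinetic T mn vn).toReal ≤ 2 * K + ‖δ‖ ^ 2 * D := by
    rw [← ENNReal.toReal_add hKp hKn]
    exact ENNReal.toReal_le_of_le_ofReal (by positivity) hkin'
  have hΨs := integral_finalMeasure_shift_add_le hadm hΨ hL ht₁ hT hζ hζ0 hζ1 δ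
  have hEn : energy T G Ψ mn vn = (((kinetic T mn vn).toReal + A +
      ∫ x, Ψ x ∂(finalMeasure T mn) : ℝ) : EReal) :=
    energy_eq_coe ENNReal.toReal_nonneg (ENNReal.ofReal_toReal hKn).symm
      ((congestion_shift G m ζ hζ.continuous (-δ)).trans hA) rfl
  -- Minimality against the `-δ` translate bounds `E₋` from below, so the bound on `E₊ + E₋` becomes
  -- an upper bound on `E₊`.
  have hminn := h.le mn vn hadmn
  rw [hE, hEn, EReal.coe_le_coe_iff] at hminn
  have hshift := measurePreserving_shift_cyl ζ hζ.continuous δ T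
  have hfinp : ∀ᵐ q ∂(cyl d T), G (mp q) ≠ ⊤ := hshift.quasiMeasurePreserving.ae hfin
  have hgp : Integrable (fun q => (G (mp q)).toReal) (cyl d T) :=
    hshift.integrable_comp_of_integrable hg
  have hAp : ∫ q, (G (mp q)).toReal ∂(cyl d T) = A :=
    hshift.integral_comp (measurableEmbedding_shift ζ hζ.continuous δ) (fun q => (G (m q)).toReal)
  have hJ : Integrable (fun q => (J (mp q) - J (m q)) ^ 2) (cyl d T) :=
    ((memLp_comp hG hc hQP hadmp.integrable hfinp hgp).sub
      (memLp_comp hG hc hQP hadm.integrable hfin hg)).integrable_sq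
  have hgg : Integrable (fun q => ((G (m q)).toReal + (G (mp q)).toReal) / 2) (cyl d T) :=
    (hg.add hgp).div_const 2
  have hu : Integrable (fun q => ((G (m q)).toReal + (G (mp q)).toReal) / 2 -
      c / 4 * (J (mp q) - J (m q)) ^ 2) (cyl d T) :=
    hgg.sub (hJ.const_mul _)
  have huint : ∫ q, (((G (m q)).toReal + (G (mp q)).toReal) / 2 -
      c / 4 * (J (mp q) - J (m q)) ^ 2) ∂(cyl d T) =
      A - c / 4 * ∫ q, (J (mp q) - J (m q)) ^ 2 ∂(cyl d T) := by
    rw [integral_sub hgg (hJ.const_mul _), integral_const_mul, integral_div,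
      integral_add hg hgp, hAp, ← hAdef, add_self_div_two]
  -- Second use of minimality: the average of the minimizer and its `δ`-translate.
  have hadmm := hadm.midpoint hadmp
  set mm : ℝ × Torus d → ℝ := fun q => (m q + mp q) / 2 with hmm
  have hGm : ∀ᵐ q ∂(cyl d T), G (mm q) ≤ ((((G (m q)).toReal + (G (mp q)).toReal) / 2 -
      c / 4 * (J (mp q) - J (m q)) ^ 2 : ℝ) : EReal) := by
    filter_upwards [hfin, hfinp] with q h1 h2
    have := hG.midpoint_le hc hQP h1 h2
    rw [← EReal.coe_toReal (hG.ne_top_midpoint h1 h2) (hG.ne_bot _), EReal.coe_le_coe_iff]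
    have hsymm : (J (mp q) - J (m q)) ^ 2 = (J (m q) - J (mp q)) ^ 2 := by ring
    rw [hsymm]
    linarith
  obtain ⟨hgm, hgmle, hAm⟩ := hG.integrable_of_le hadmm.integrable hu hGm
  have hAmle := integral_mono_ae hgm hu hgmle
  rw [huint] at hAmle
  have hKm := kinetic_midpoint_le hadm.nonneg hadmp.nonneg hK hKp
    hadm.integrable.aemeasurable hadm.measurable_field
  have hKmle := ENNReal.toReal_le_of_le_ofReal (by positivity) hKm
  have hEm := energy_eq_coe (Ψ := Ψ) ENNReal.toReal_nonneg
    (ENNReal.ofReal_toReal (ne_top_of_le_ne_top ENNReal.ofReal_ne_top hKm)).symm hAm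
    (integral_finalMeasure_midpoint hT0 hadm hadmp hΨ)
  have hminm := h.le _ _ hadmm
  rw [hE, hEm, EReal.coe_le_coe_iff] at hminm
  -- What remains is `(c/4) ∫ (J(m₊) - J(m))² ≤ (E₊ - E)/2 ≤ (D + L)‖δ‖²/2`.
  rw [div_mul_eq_mul_div, le_div_iff₀ hc]
  linarith

theorem cylFrom_le_cyl {t₁ : ℝ} (ht₁ : 0 < t₁) : cylFrom d t₁ T ≤ cyl d T := by
  unfold cylFrom cyl
  refine Measure.prod_mono ?_ le_rfl
  rw [← Measure.restrict_congr_set (Ioo_ae_eq_Icc (μ := volume) (a := t₁) (b := T))]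
  exact Measure.restrict_mono (Ioo_subset_Ioo_left ht₁.le) le_rfl

/-- The translation estimate. -/
theorem exists_translation_bound (hG : IsPenalization G) (hΨ : IsC11 Ψ) (hc : 0 < c) {t₁ : ℝ}
    (ht₁ : 0 < t₁) : ∃ C : ℝ, ∀ J Js : ℝ → ℝ, QP G c J Js → ∀ T : ℝ, ∀ m₀ : Measure (Torus d),
      ∀ (m : ℝ × Torus d → ℝ) (v : ℝ × Torus d → E d), IsMinimizer T G Ψ m₀ m v → ∀ δ : E d,
      eLpNorm (fun q : ℝ × Torus d => J (m (q.1, q.2 + proj δ)) - J (m q)) 2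
        (cylFrom d t₁ T) ≤ ENNReal.ofReal (C * ‖δ‖) := by
  obtain ⟨L, hL0, hL⟩ := hΨ.exists_second_difference_le
  obtain ⟨ζ, D, hζ, hζ0, hζ1, hD0, hD⟩ := exists_cutoff ht₁
  have hΨc : Continuous Ψ := continuous_of_comp_proj' hΨ.1.continuous
  -- `L` comes from `Ψ` alone and `D` from `t₁` alone.
  refine ⟨√(2 * (D + L) / c), fun J Js hQP T m₀ m v h δ => ?_⟩
  rcases le_or_gt T t₁ with hT | hT
  · have : cylFrom d t₁ T = 0 := by
      rw [cylFrom, Measure.restrict_eq_zero.2, Measure.zero_prod]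
      rw [Real.volume_Icc, ENNReal.ofReal_eq_zero]
      linarith
    simp [this]
  have hmain := h.integral_sq_le hG hΨc hL hc hQP ht₁ hT hζ hζ0 hζ1 hD0 (hD T) δ
  have hadm := h.admissible
  obtain ⟨-, hg, hfin, -⟩ := hG.of_energy_lt_top hadm.integrable h.finite
  have hshift := measurePreserving_shift_cyl ζ hζ.continuous δ T
  have hmem := memLp_comp hG hc hQP hadm.integrable hfin hg
  have hmemd : MemLp (fun q => J (m (shift ζ hζ.continuous δ q)) - J (m q)) 2 (cyl d T) :=
    (hmem.comp_measurePreserving hshift).sub hmem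
  have hae : (fun q : ℝ × Torus d => J (m (q.1, q.2 + proj δ)) - J (m q)) =ᵐ[cylFrom d t₁ T]
      fun q => J (m (shift ζ hζ.continuous δ q)) - J (m q) := by
    have : ∀ᵐ q ∂(cylFrom d t₁ T), q.1 ∈ Icc t₁ T :=
      Measure.quasiMeasurePreserving_fst.ae (ae_restrict_mem measurableSet_Icc)
    filter_upwards [this] with q hq
    simp [shift_apply, hζ1 q.1 hq.1]
  rw [eLpNorm_congr_ae hae]
  refine (eLpNorm_mono_measure _ (cylFrom_le_cyl ht₁)).trans ?_
  rw [hmemd.eLpNorm_eq_integral_rpow_norm (by norm_num) (by norm_num)]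
  refine ENNReal.ofReal_le_ofReal ?_
  simp only [ENNReal.toReal_ofNat, Real.rpow_two, Real.norm_eq_abs, sq_abs]
  rw [← one_div, ← Real.sqrt_eq_rpow]
  refine (Real.sqrt_le_sqrt hmain).trans (le_of_eq ?_)
  rw [Real.sqrt_mul (by positivity), Real.sqrt_sq (norm_nonneg _)]

end Estimate

/-! ### Weak limits of difference quotients and weak gradients -/

theorem exists_weak_cluster_point {H ι : Type*} [NormedAddCommGroup H] [InnerProductSpace ℝ H]
    [CompleteSpace H] (l : Filter ι) [l.NeBot] {D : ι → H} {C : ℝ} (hD : ∀ i, ‖D i‖ ≤ C) :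
    ∃ (w : H) (l' : Filter ι), l'.NeBot ∧ l' ≤ l ∧
      ∀ g : H, Filter.Tendsto (fun i => inner ℝ (D i) g) l' (nhds (inner ℝ w g)) := by
  let u : ι → WeakDual ℝ H := fun i =>
    StrongDual.toWeakDual (InnerProductSpace.toDual ℝ H (D i))
  -- Banach–Alaoglu along an ultrafilter gives a limit against all `g` at once, with no extraction
  -- of subsequences.
  let U : Ultrafilter ι := Ultrafilter.of l
  have hmem : ((U.map u : Ultrafilter (WeakDual ℝ H)) : Filter (WeakDual ℝ H)) ≤
      Filter.principal (WeakDual.toStrongDual ⁻¹' Metric.closedBall (0 : StrongDual ℝ H) C) := by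
    rw [Filter.le_principal_iff, Ultrafilter.coe_map]
    refine Filter.mem_map.2 (Filter.univ_mem' fun i => mem_closedBall_zero_iff.2 ?_)
    change ‖InnerProductSpace.toDual ℝ H (D i)‖ ≤ C
    rw [LinearIsometryEquiv.norm_map]
    exact hD i
  obtain ⟨ℓ, -, hℓ⟩ := (WeakDual.isCompact_closedBall (0 : StrongDual ℝ H) C).ultrafilter_le_nhds
    (U.map u) hmem
  refine ⟨(InnerProductSpace.toDual ℝ H).symm (WeakDual.toStrongDual ℓ), U, inferInstance,
    Ultrafilter.of_le l, fun g => ?_⟩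
  have h1 : Filter.Tendsto u U (nhds ℓ) := hℓ
  have h2 := ((WeakDual.eval_continuous g).tendsto ℓ).comp h1
  rw [InnerProductSpace.toDual_symm_apply]
  exact h2

theorem MemLp.exists_weak_cluster_point {X ι : Type*} [MeasurableSpace X] {μ : Measure X}
    (l : Filter ι) [l.NeBot] {D : ι → X → ℝ} (hD : ∀ i, MemLp (D i) 2 μ) {C : ℝ}
    (hC : ∀ i, eLpNorm (D i) 2 μ ≤ ENNReal.ofReal C) :
    ∃ (w : X → ℝ) (l' : Filter ι), MemLp w 2 μ ∧ l'.NeBot ∧ l' ≤ l ∧ ∀ g : X → ℝ, MemLp g 2 μ →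
      Filter.Tendsto (fun i => ∫ x, D i x * g x ∂μ) l' (nhds (∫ x, w x * g x ∂μ)) := by
  obtain ⟨w, l', hl', hle, hw⟩ := MFG.exists_weak_cluster_point l
    (D := fun i => (hD i).toLp (D i)) (C := max C 0) fun i => by
      rw [Lp.norm_toLp]
      refine ENNReal.toReal_le_of_le_ofReal (le_max_right _ _) ((hC i).trans ?_)
      exact ENNReal.ofReal_le_ofReal (le_max_left _ _)
  refine ⟨w, l', Lp.memLp w, hl', hle, fun g hg => ?_⟩
  have key := hw (hg.toLp g)
  simp only [L2.inner_def] at key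
  have e1 : ∀ i, ∫ x, inner ℝ ((hD i).toLp (D i) x) (hg.toLp g x) ∂μ = ∫ x, D i x * g x ∂μ := by
    intro i
    refine integral_congr_ae ?_
    filter_upwards [(hD i).coeFn_toLp, hg.coeFn_toLp] with x h1 h2
    rw [h1, h2, real_inner_eq_re_inner, RCLike.inner_apply, conj_trivial, mul_comm]
    rfl
  have e2 : ∫ x, inner ℝ (w x) (hg.toLp g x) ∂μ = ∫ x, w x * g x ∂μ := by
    refine integral_congr_ae ?_
    filter_upwards [hg.coeFn_toLp] with x h2
    rw [h2, real_inner_eq_re_inner, RCLike.inner_apply, conj_trivial, mul_comm]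
    rfl
  simp only [e1] at key
  rwa [e2] at key

theorem exists_bound_torusGrad {ψ : Torus d → ℝ} (hψ : ContDiff ℝ 1 fun x : E d => ψ (proj x)) :
    ∃ M : ℝ, 0 ≤ M ∧ (∀ x, ‖torusGrad ψ x‖ ≤ M) ∧
      ∀ x δ, |ψ (x + proj δ) - ψ x| ≤ M * ‖δ‖ := by
  obtain ⟨M, hM⟩ := (isCompact_univ (X := Torus d)).exists_bound_of_continuousOn
    (continuous_torusGrad hψ).continuousOn
  have hM0 : 0 ≤ M := (norm_nonneg _).trans (hM 0 (mem_univ _))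
  refine ⟨M, hM0, fun x => hM x (mem_univ x), fun x δ => ?_⟩
  obtain ⟨y, rfl⟩ := proj_surjective x
  have := (convex_univ (𝕜 := ℝ) (E := E d)).norm_image_sub_le_of_norm_fderiv_le (𝕜 := ℝ)
    (f := fun x : E d => ψ (proj x)) (C := M)
    (fun z _ => hψ.differentiable one_ne_zero z) (fun z _ => ?_) (mem_univ y) (mem_univ (y + δ))
  · simpa [proj_add] using this
  · have h := hM (proj z) (mem_univ _)
    rw [torusGrad_proj] at h
    unfold gradient at h
    rwa [LinearIsometryEquiv.norm_map] at h

theorem tendsto_difference_quotient {ψ : Torus d → ℝ}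
    (hψ : ContDiff ℝ 1 fun x : E d => ψ (proj x)) (e : E d) (x : Torus d) :
    Filter.Tendsto (fun n : ℕ => ((n : ℝ) + 1) * (ψ (x - proj (((n : ℝ) + 1)⁻¹ • e)) - ψ x))
      Filter.atTop (nhds (-inner ℝ (torusGrad ψ x) e)) := by
  obtain ⟨y, rfl⟩ := proj_surjective x
  have h1 : HasDerivAt (fun s : ℝ => ψ (proj (y - s • e))) (-inner ℝ (torusGrad ψ (proj y)) e) 0 := by
    have h2 : HasDerivAt (fun s : ℝ => y - s • e) (-e) 0 := by
      simpa using ((hasDerivAt_id (0 : ℝ)).smul_const e).const_sub y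
    have h3 : HasFDerivAt (fun x : E d => ψ (proj x)) (fderiv ℝ (fun x : E d => ψ (proj x)) y)
        (y - (0 : ℝ) • e) := by
      simpa using (hψ.differentiable one_ne_zero y).hasFDerivAt
    have h4 := h3.comp_hasDerivAt 0 h2
    rw [torusGrad_proj, inner_gradient_left, ← map_neg]
    exact h4
  have hseq : Filter.Tendsto (fun n : ℕ => ((n : ℝ) + 1)⁻¹) Filter.atTop (nhdsWithin 0 {0}ᶜ) := by
    refine tendsto_nhdsWithin_iff.2 ⟨?_, .of_forall fun n => ?_⟩
    · simpa using tendsto_one_div_add_atTop_nhds_zero_nat (𝕜 := ℝ)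
    · simp only [mem_compl_iff, mem_singleton_iff]
      positivity
  have h5 := h1.tendsto_slope_zero.comp hseq
  refine h5.congr fun n => ?_
  simp [proj_sub]

section SliceGradient

variable {ν : Measure ℝ} [IsFiniteMeasure ν] {f : ℝ × Torus d → ℝ}

/-- A direction in which the difference quotients of `f` are bounded in `L²` carries a weak
derivative in `L²`. -/
theorem exists_weak_directional_deriv (hf : MemLp f 2 (ν.prod volume)) {C : ℝ}
    (hC : ∀ δ : E d, eLpNorm (fun q : ℝ × Torus d => f (q.1, q.2 + proj δ) - f q) 2
      (ν.prod volume) ≤ ENNReal.ofReal (C * ‖δ‖)) (e : E d) :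
    ∃ w : ℝ × Torus d → ℝ, MemLp w 2 (ν.prod volume) ∧
      ∀ ψ : Torus d → ℝ, (ContDiff ℝ 1 fun x : E d => ψ (proj x)) →
        ∀ᵐ t ∂ν, ∫ x, f (t, x) * inner ℝ (torusGrad ψ x) e = -∫ x, w (t, x) * ψ x := by
  set S : ℕ → (ℝ × Torus d) ≃ₜ (ℝ × Torus d) := fun n =>
    shift (fun _ => 1) continuous_const (((n : ℝ) + 1)⁻¹ • e) with hS
  have hSmp : ∀ n, MeasurePreserving (S n) (ν.prod volume) (ν.prod volume) := fun n =>
    measurePreserving_shift _ _ _ ν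
  have hfS : ∀ n, MemLp (fun q => f (S n q)) 2 (ν.prod volume) := fun n =>
    hf.comp_measurePreserving (hSmp n)
  set D : ℕ → ℝ × Torus d → ℝ := fun n q => ((n : ℝ) + 1) * (f (S n q) - f q) with hD
  have hDmem : ∀ n, MemLp (D n) 2 (ν.prod volume) := fun n => ((hfS n).sub hf).const_mul _
  have hDC : ∀ n, eLpNorm (D n) 2 (ν.prod volume) ≤ ENNReal.ofReal (C * ‖e‖) := by
    intro n
    have h1 : D n = ((n : ℝ) + 1) • fun q : ℝ × Torus d =>
        f (q.1, q.2 + proj (((n : ℝ) + 1)⁻¹ • e)) - f q := by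
      funext q
      simp [hD, hS, shift_apply]
    have hpos : (0 : ℝ) < (n : ℝ) + 1 := by positivity
    rw [h1, eLpNorm_const_smul, ← ofReal_norm, Real.norm_of_nonneg hpos.le]
    refine (mul_le_mul_right (hC _) _).trans ?_
    rw [← ENNReal.ofReal_mul hpos.le, norm_smul, norm_inv, Real.norm_of_nonneg hpos.le]
    refine ENNReal.ofReal_le_ofReal (le_of_eq ?_)
    field_simp
  obtain ⟨w, l', hw, hl', hle, hlim⟩ := MemLp.exists_weak_cluster_point Filter.atTop hDmem hDC
  refine ⟨w, hw, fun ψ hψ => ?_⟩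
  have hψc : Continuous ψ := continuous_of_comp_proj' hψ.continuous
  have hgc := continuous_torusGrad hψ
  obtain ⟨M, hM0, hMg, hMψ⟩ := exists_bound_torusGrad hψ
  obtain ⟨N, hN⟩ := (isCompact_univ (X := Torus d)).exists_bound_of_continuousOn hψc.continuousOn
  have hfi : Integrable f (ν.prod volume) := hf.integrable one_le_two
  have hwi : Integrable w (ν.prod volume) := hw.integrable one_le_two
  have hge : Integrable (fun q : ℝ × Torus d => f q * inner ℝ (torusGrad ψ q.2) e)
      (ν.prod volume) := by
    refine hfi.mul_bdd (c := M * ‖e‖)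
      ((hgc.comp continuous_snd).inner continuous_const).aestronglyMeasurable
      (.of_forall fun q => (norm_inner_le_norm _ _).trans ?_)
    exact mul_le_mul_of_nonneg_right (hMg _) (norm_nonneg _)
  have hwψ : Integrable (fun q : ℝ × Torus d => w q * ψ q.2) (ν.prod volume) :=
    hwi.mul_bdd (hψc.comp continuous_snd).aestronglyMeasurable
      (.of_forall fun q => hN _ (mem_univ _))
  have hae := Integrable.ae_eq_of_forall_setIntegral_eq
    (fun t => ∫ x, f (t, x) * inner ℝ (torusGrad ψ x) e) (fun t => -∫ x, w (t, x) * ψ x)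
    hge.integral_prod_left hwψ.integral_prod_left.neg ?_
  · exact hae
  intro A hA _
  -- Testing with `1_A(t) ψ(x)` for all measurable `A` localizes the identity to almost every `t`.
  set g : ℝ × Torus d → ℝ := fun q => A.indicator 1 q.1 * ψ q.2 with hg
  have hχm : Measurable fun q : ℝ × Torus d => A.indicator (1 : ℝ → ℝ) q.1 :=
    (measurable_one.indicator hA).comp measurable_fst
  have hχ : ∀ t, |A.indicator (1 : ℝ → ℝ) t| ≤ 1 := fun t => by
    by_cases h : t ∈ A <;> simp [h]
  have hgm : AEStronglyMeasurable g (ν.prod volume) :=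
    (hχm.mul (hψc.comp continuous_snd).measurable).aestronglyMeasurable
  have hgmem : MemLp g 2 (ν.prod volume) := by
    refine MemLp.of_bound hgm (1 * N) (.of_forall fun q => ?_)
    rw [hg, norm_mul]
    exact mul_le_mul (hχ _) (hN _ (mem_univ _)) (norm_nonneg _) zero_le_one
  -- Discrete integration by parts: invariance of the measure moves the translation from `f` to `ψ`,
  -- reversing its sign.
  have hDg : ∀ n, ∫ q, D n q * g q ∂(ν.prod volume) = ∫ q, f q *
      (A.indicator 1 q.1 * (((n : ℝ) + 1) * (ψ (q.2 - proj (((n : ℝ) + 1)⁻¹ • e)) - ψ q.2)))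
        ∂(ν.prod volume) := by
    intro n
    have hgS : MemLp (fun q => g ((S n).symm q)) 2 (ν.prod volume) :=
      hgmem.comp_measurePreserving ((hSmp n).symm (S n).toMeasurableEquiv)
    have e1 : ∫ q, f (S n q) * g q ∂(ν.prod volume) =
        ∫ q, f q * g ((S n).symm q) ∂(ν.prod volume) := by
      rw [← (hSmp n).integral_comp (S n).measurableEmbedding fun q => f q * g ((S n).symm q)]
      simp only [Homeomorph.symm_apply_apply]
    have i1 : Integrable (fun q => f (S n q) * g q) (ν.prod volume) := (hfS n).integrable_mul hgmem
    have i2 : Integrable (fun q => f q * g q) (ν.prod volume) := hf.integrable_mul hgmem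
    have i3 : Integrable (fun q => f q * g ((S n).symm q)) (ν.prod volume) :=
      hf.integrable_mul hgS
    calc ∫ q, D n q * g q ∂(ν.prod volume)
        = ∫ q, ((n : ℝ) + 1) * (f (S n q) * g q - f q * g q) ∂(ν.prod volume) := by
          refine integral_congr_ae (.of_forall fun q => ?_)
          simp only [hD]; ring
      _ = ∫ q, ((n : ℝ) + 1) * (f q * g ((S n).symm q) - f q * g q) ∂(ν.prod volume) := by
          rw [integral_const_mul, integral_sub i1 i2, e1, ← integral_sub i3 i2,
            ← integral_const_mul]
      _ = _ := by
          refine integral_congr_ae (.of_forall fun q => ?_)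
          have : g ((S n).symm q) =
              A.indicator 1 q.1 * ψ (q.2 - proj (((n : ℝ) + 1)⁻¹ • e)) := by
            change A.indicator 1 q.1 * ψ (q.2 - proj ((1 : ℝ) • ((n : ℝ) + 1)⁻¹ • e)) = _
            rw [one_smul]
          simp only [this]
          simp only [hg]
          ring
  have hlim1 : Filter.Tendsto (fun n => ∫ q, D n q * g q ∂(ν.prod volume)) Filter.atTop
      (nhds (∫ q, f q * (A.indicator 1 q.1 * -inner ℝ (torusGrad ψ q.2) e) ∂(ν.prod volume))) := by
    simp only [hDg]
    refine tendsto_integral_of_dominated_convergence (fun q => ‖f q‖ * (M * ‖e‖)) (fun n => ?_)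
      (hfi.norm.mul_const _) (fun n => .of_forall fun q => ?_) (.of_forall fun q => ?_)
    · refine hf.1.mul (hχm.mul (measurable_const.mul (Measurable.sub ?_ ?_))).aestronglyMeasurable
      · exact (hψc.comp (continuous_snd.sub continuous_const)).measurable
      · exact (hψc.comp continuous_snd).measurable
    · have hpos : (0 : ℝ) < (n : ℝ) + 1 := by positivity
      rw [norm_mul]
      refine mul_le_mul_of_nonneg_left ?_ (norm_nonneg _)
      rw [norm_mul, norm_mul, Real.norm_of_nonneg hpos.le]
      have h1 := hMψ q.2 (-(((n : ℝ) + 1)⁻¹ • e))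
      rw [proj_neg, ← sub_eq_add_neg, norm_neg, norm_smul, norm_inv,
        Real.norm_of_nonneg hpos.le] at h1
      calc _ ≤ 1 * (((n : ℝ) + 1) * (M * ((n + 1 : ℝ)⁻¹ * ‖e‖))) :=
            mul_le_mul (hχ _) (mul_le_mul_of_nonneg_left h1 hpos.le) (by positivity) zero_le_one
        _ = M * ‖e‖ := by field_simp
    · exact ((tendsto_difference_quotient hψ e q.2).const_mul _).const_mul _
  -- The weak limit along `l'` and the full limit from dominated convergence must coincide.
  have heq := tendsto_nhds_unique (hlim1.mono_left hle) (hlim g hgmem)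
  have hset : ∀ F : ℝ × Torus d → ℝ, Integrable F (ν.prod volume) →
      ∫ q, A.indicator 1 q.1 * F q ∂(ν.prod volume) = ∫ t in A, (∫ x, F (t, x)) ∂ν := by
    intro F hF
    have hF' : Integrable (fun q : ℝ × Torus d => A.indicator 1 q.1 * F q) (ν.prod volume) :=
      hF.bdd_mul hχm.aestronglyMeasurable (.of_forall fun q => hχ _)
    rw [integral_prod _ hF', ← integral_indicator hA]
    refine integral_congr_ae (.of_forall fun t => ?_)
    by_cases h : t ∈ A <;> simp [h]
  have e1 : ∫ q, f q * (A.indicator 1 q.1 * -inner ℝ (torusGrad ψ q.2) e) ∂(ν.prod volume) =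
      -∫ t in A, (∫ x, f (t, x) * inner ℝ (torusGrad ψ x) e) ∂ν := by
    rw [← hset _ hge, ← integral_neg]
    refine integral_congr_ae (.of_forall fun q => ?_)
    simp only
    ring
  have e2 : ∫ q, w q * g q ∂(ν.prod volume) = ∫ t in A, (∫ x, w (t, x) * ψ x) ∂ν := by
    rw [← hset _ hwψ]
    refine integral_congr_ae (.of_forall fun q => ?_)
    simp only [hg]
    ring
  rw [e1, e2] at heq
  rw [integral_neg, ← heq, neg_neg]

theorem exists_weak_gradient_forall_test (hf : MemLp f 2 (ν.prod volume)) {C : ℝ}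
    (hC : ∀ δ : E d, eLpNorm (fun q : ℝ × Torus d => f (q.1, q.2 + proj δ) - f q) 2
      (ν.prod volume) ≤ ENNReal.ofReal (C * ‖δ‖)) :
    ∃ w : ℝ × Torus d → E d, MemLp w 2 (ν.prod volume) ∧
      ∀ ψ : Torus d → ℝ, (ContDiff ℝ 1 fun x : E d => ψ (proj x)) →
        ∀ᵐ t ∂ν, ∫ x, f (t, x) • torusGrad ψ x = -∫ x, ψ x • w (t, x) := by
  choose w hw hwψ using fun i : Fin d =>
    exists_weak_directional_deriv hf hC (EuclideanSpace.single i (1 : ℝ))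
  have hmem : MemLp (fun q => (WithLp.toLp 2 fun i => w i q : E d)) 2 (ν.prod volume) :=
    memLp_piLp_iff.2 hw
  refine ⟨_, hmem, fun ψ hψ => ?_⟩
  have hψc : Continuous ψ := continuous_of_comp_proj' hψ.continuous
  have hgc := continuous_torusGrad hψ
  obtain ⟨M, -, hM, -⟩ := exists_bound_torusGrad hψ
  obtain ⟨N, hN⟩ := (isCompact_univ (X := Torus d)).exists_bound_of_continuousOn hψc.continuousOn
  filter_upwards [ae_all_iff.2 fun i => hwψ i ψ hψ,
    (hf.integrable one_le_two).prod_right_ae, (hmem.integrable one_le_two).prod_right_ae]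
    with t ht hft hwt
  have i1 : Integrable fun x => f (t, x) • torusGrad ψ x :=
    hft.smul_bdd M hgc.aestronglyMeasurable (.of_forall hM)
  have i2 : Integrable fun x => ψ x • (WithLp.toLp 2 fun i => w i (t, x) : E d) :=
    hwt.bdd_smul N hψc.aestronglyMeasurable (.of_forall fun x => hN x (mem_univ x))
  ext i
  rw [PiLp.neg_apply, eval_integral_piLp fun i => i1.eval_piLp i,
    eval_integral_piLp fun i => i2.eval_piLp i]
  simpa [EuclideanSpace.inner_single_right, mul_comm] using ht i

theorem exists_weak_gradient (hf : MemLp f 2 (ν.prod volume)) {C : ℝ}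
    (hC : ∀ δ : E d, eLpNorm (fun q : ℝ × Torus d => f (q.1, q.2 + proj δ) - f q) 2
      (ν.prod volume) ≤ ENNReal.ofReal (C * ‖δ‖)) :
    ∃ w : ℝ × Torus d → E d, MemLp w 2 (ν.prod volume) ∧
      ∀ᵐ t ∂ν, IsWeakGradient (fun x => f (t, x)) (fun x => w (t, x)) := by
  obtain ⟨w, hw, hwψ⟩ := exists_weak_gradient_forall_test hf hC
  refine ⟨w, hw, ?_⟩
  -- So far the null set of times depends on the test function. The pairs `(ψ, ∇ψ)` form a subset of
  -- a separable metric space, so a countable family is dense among them uniformly with gradients.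
  -- One null set serves that family, and both sides are continuous in the pair.
  let 𝒮 : Set C(Torus d, ℝ × E d) := {F | (ContDiff ℝ 1 fun x : E d => (F (proj x)).1) ∧
    ∀ x, (F x).2 = torusGrad (fun x => (F x).1) x}
  obtain ⟨𝒟, h𝒟𝒮, h𝒟c, h𝒟⟩ :=
    (TopologicalSpace.IsSeparable.of_separableSpace 𝒮).exists_countable_dense_subset
  have hall : ∀ᵐ t ∂ν, ∀ F ∈ 𝒟, ∫ x, f (t, x) • (F x).2 = -∫ x, (F x).1 • w (t, x) := by
    refine (ae_ball_iff h𝒟c).2 fun F hF => ?_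
    obtain ⟨h1, h2⟩ := h𝒟𝒮 hF
    simp only [h2]
    exact hwψ _ h1
  filter_upwards [hall, (hf.integrable one_le_two).prod_right_ae,
    (hw.integrable one_le_two).prod_right_ae] with t ht hft hwt φ hφ
  have hφ1 : ContDiff ℝ 1 fun x : E d => φ (proj x) := hφ.of_le (by exact_mod_cast le_top)
  have hφc : Continuous φ := continuous_of_comp_proj' hφ.continuous
  let F₀ : C(Torus d, ℝ × E d) :=
    ⟨fun x => (φ x, torusGrad φ x), hφc.prodMk (continuous_torusGrad hφ1)⟩
  have hF₀ : F₀ ∈ 𝒮 := ⟨hφ1, fun x => rfl⟩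
  have c1 : Continuous fun F : C(Torus d, ℝ × E d) => ∫ x, f (t, x) • (F x).2 :=
    continuous_integral_continuousMap (B := fun x (y : ℝ × E d) => f (t, x) • y.2)
      (fun x => continuous_snd.const_smul (f (t, x))) hft.norm
      (fun x y => by
        rw [norm_smul]
        exact mul_le_mul_of_nonneg_left (norm_snd_le y) (norm_nonneg _))
      fun F => hft.1.smul F.continuous.snd.aestronglyMeasurable
  have c2 : Continuous fun F : C(Torus d, ℝ × E d) => ∫ x, (F x).1 • w (t, x) :=
    continuous_integral_continuousMap (B := fun x (y : ℝ × E d) => y.1 • w (t, x))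
      (fun x => continuous_fst.smul continuous_const) hwt.norm
      (fun x y => by
        rw [norm_smul, mul_comm]
        exact mul_le_mul_of_nonneg_left (norm_fst_le y) (norm_nonneg _))
      fun F => F.continuous.fst.aestronglyMeasurable.smul hwt.1
  exact closure_minimal ht (isClosed_eq c1 c2.neg) (h𝒟 hF₀)

end SliceGradient

/-! ### Local-in-time gluing and conclusion -/

/-- Gluing the gradients obtained on the slabs `[T/(k+1), T]`. -/
theorem memL2locH1_of_translation_bound (hT : 0 < T) {f : ℝ × Torus d → ℝ}
    (hf : ∀ t₁ : ℝ, 0 < t₁ → MemLp f 2 (cylFrom d t₁ T))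
    (h : ∀ t₁ : ℝ, 0 < t₁ → ∃ C : ℝ, ∀ δ : E d,
      eLpNorm (fun q : ℝ × Torus d => f (q.1, q.2 + proj δ) - f q) 2 (cylFrom d t₁ T) ≤
        ENNReal.ofReal (C * ‖δ‖)) : MemL2locH1 T f := by
  have hpos : ∀ k : ℕ, 0 < T / (k + 1) := fun k => by positivity
  have hex : ∀ k : ℕ, ∃ w : ℝ × Torus d → E d,
      MemLp w 2 ((volume : Measure ℝ).prod (volume : Measure (Torus d))) ∧
      ∀ᵐ t ∂(volume.restrict (Icc (T / (k + 1)) T)),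
        IsWeakGradient (fun x => f (t, x)) (fun x => w (t, x)) := by
    intro k
    obtain ⟨C, hC⟩ := h _ (hpos k)
    obtain ⟨w, hw, hwg⟩ := exists_weak_gradient (hf _ (hpos k)) hC
    have hms : MeasurableSet (Icc (T / (k + 1)) T ×ˢ (univ : Set (Torus d))) :=
      measurableSet_Icc.prod MeasurableSet.univ
    refine ⟨(Icc (T / (k + 1)) T ×ˢ univ).indicator w, ?_, ?_⟩
    · rw [memLp_indicator_iff_restrict hms, ← Measure.prod_restrict, Measure.restrict_univ]
      exact hw
    · filter_upwards [hwg, ae_restrict_mem measurableSet_Icc] with t ht hmem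
      have : (fun x => (Icc (T / (k + 1)) T ×ˢ univ).indicator w (t, x)) = fun x => w (t, x) := by
        funext x
        exact indicator_of_mem (mk_mem_prod hmem (mem_univ x)) _
      rwa [this]
  choose w hw hwg using hex
  -- With `N(t) = ⌈T/t⌉` one has `T/(N(t) + 1) ≤ t`, so `t` lies in the slab number `N(t)`.
  set N : ℝ → ℕ := fun t => ⌈T / t⌉₊ with hN
  have hNm : Measurable N := Nat.measurable_ceil.comp (measurable_const.div measurable_id)
  refine ⟨fun q => w (N q.1) q, fun t₁ ht₁ => ⟨hf t₁ ht₁, ?_⟩, ?_⟩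
  · have hle : cylFrom d t₁ T ≤ (volume : Measure ℝ).prod volume :=
      Measure.prod_mono Measure.restrict_le_self le_rfl
    -- For `t ≥ t₁` only the indices up to `⌈T/t₁⌉` occur, so on this slab the glued field is a
    -- finite sum of `L²` pieces.
    have hsum : MemLp (fun q => ∑ k ∈ Finset.range (⌈T / t₁⌉₊ + 1),
        {q : ℝ × Torus d | N q.1 = k}.indicator (w k) q) 2 (cylFrom d t₁ T) :=
      memLp_finsetSum _ fun k _ => ((hw k).mono_measure hle).indicator
        ((hNm.comp measurable_fst) (measurableSet_singleton k))
    refine hsum.ae_eq ?_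
    have : ∀ᵐ q ∂(cylFrom d t₁ T), q.1 ∈ Icc t₁ T :=
      Measure.quasiMeasurePreserving_fst.ae (ae_restrict_mem measurableSet_Icc)
    filter_upwards [this] with q hq
    rw [Finset.sum_eq_single (N q.1)]
    · exact indicator_of_mem (show q ∈ {q : ℝ × Torus d | N q.1 = N _} from rfl) _
    · intro k _ hk
      exact indicator_of_notMem (s := {q : ℝ × Torus d | N q.1 = k}) (fun hmem => hk hmem.symm) _
    · intro hnot
      refine absurd (Finset.mem_range.2 (Nat.lt_succ_of_le (Nat.ceil_mono ?_))) hnot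
      exact div_le_div_of_nonneg_left hT.le ht₁ hq.1
  · have hall : ∀ᵐ t : ℝ, ∀ k : ℕ, t ∈ Icc (T / (k + 1)) T →
        IsWeakGradient (fun x => f (t, x)) (fun x => w k (t, x)) :=
      ae_all_iff.2 fun k => (ae_restrict_iff' measurableSet_Icc).1 (hwg k)
    filter_upwards [ae_restrict_of_ae hall, ae_restrict_mem measurableSet_Ioo] with t ht hmem
    refine ht (N t) ⟨?_, hmem.2.le⟩
    have h1 : T / t ≤ N t := Nat.le_ceil _
    rw [div_le_iff₀ hmem.1] at h1
    rw [div_le_iff₀ (by positivity)]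
    linarith [hmem.1]

end MFG

theorem mainTheorem2 (d : ℕ) (G : ℝ → EReal) (hG : MFG.IsPenalization G)
    (Ψ : MFG.Torus d → ℝ) (hΨ : MFG.IsC11 Ψ) (c : ℝ) (hc : 0 < c) :
    (∀ t₁ : ℝ, 0 < t₁ → ∃ C : ℝ, ∀ J Js : ℝ → ℝ, MFG.QP G c J Js →
      ∀ T : ℝ, 0 < T → ∀ m₀ : Measure (MFG.Torus d), IsProbabilityMeasure m₀ →
      ∀ (m : ℝ × MFG.Torus d → ℝ) (v : ℝ × MFG.Torus d → MFG.E d),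
        MFG.IsMinimizer T G Ψ m₀ m v →
        ∀ δ : MFG.E d,
          eLpNorm (fun q : ℝ × MFG.Torus d => J (m (q.1, q.2 + MFG.proj δ)) - J (m q)) 2
            (MFG.cylFrom d t₁ T) ≤ ENNReal.ofReal (C * ‖δ‖)) ∧
    (∀ J Js : ℝ → ℝ, MFG.QP G c J Js →
      ∀ T : ℝ, 0 < T → ∀ m₀ : Measure (MFG.Torus d), IsProbabilityMeasure m₀ →
      ∀ (m : ℝ × MFG.Torus d → ℝ) (v : ℝ × MFG.Torus d → MFG.E d),
        MFG.IsMinimizer T G Ψ m₀ m v →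
        MFG.MemL2locH1 T (fun q => J (m q))) := by
  refine ⟨fun t₁ ht₁ => ?_, fun J Js hQP T hT m₀ _ m v h => ?_⟩
  · obtain ⟨C, hC⟩ := MFG.exists_translation_bound hG hΨ hc ht₁
    exact ⟨C, fun J Js hQP T _ m₀ _ m v h δ => hC J Js hQP T m₀ m v h δ⟩
  · obtain ⟨-, hg, hfin, -⟩ := hG.of_energy_lt_top h.admissible.integrable h.finite
    have hmem := MFG.memLp_comp hG hc hQP h.admissible.integrable hfin hg
    refine MFG.memL2locH1_of_translation_bound hT
      (fun t₁ ht₁ => hmem.mono_measure (MFG.cylFrom_le_cyl ht₁)) fun t₁ ht₁ => ?_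
    obtain ⟨C, hC⟩ := MFG.exists_translation_bound hG hΨ hc ht₁
    exact ⟨C, fun δ => hC J Js hQP T m₀ m v h δ⟩
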